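/- Let $M$ be a smooth $n$-dimensional manifold, $g$ a flat (pseudo-Riemannian) metric on $M$ and $\omega$ a symplectic form on $M$. In local coordinates $u^1,\dots,u^n$ write $g_{ij}$, $\omega_{ij}$ for their components, and $g^{ij}$, $\omega^{ij}$ for the inverse matrices ($g_{ir}g^{rj}=\omega_{ir}\omega^{rj}=\delta_i^j$). Sums over repeated indices are understood, and round brackets on indices denote symmetrisation, $c^{ij}_{(k,l)}=\frac12(\partial_l c^{ij}_k+\partial_k c^{ij}_l)$. The hydrodynamic operator specified by $g$ is $$P_1^{ij}=g^{ij}\frac{d}{dx}-g^{ir}\,\Gamma^{j}_{rk}[g]\,u^k_x ,$$ where $\Gamma^{j}_{rk}[g]$ are the Christoffel symbols of the Levi-Civita connection of $g$. A flat symplectic connection for $\omega$ is a smooth torsion-free connection $\nabla$ on $TM$ with $\nabla\omega=0$ and vanishing curvature. If $\Gamma^{j}_{rk}$ are its Christoffel symbols and $c^{ij}_k=-\omega^{ir}\Gamma^j_{rk}$, the degree-2 operator specified by $(\omega,\nabla)$ is $$P_2^{ij}=\omega^{ij}\Big(\frac{d}{dx}\Big)^2+2c^{ij}_k u^k_x\frac{d}{dx}+c^{ij}_{kl}u^k_xu^l_x+c^{ij}_ku^k_{xx},\qquad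 c^{ij}_{kl}=c^{ij}_{(k,l)}-\omega_{pr}\,c^{ri}_{(k}c^{pj}_{l)} .$$ An operator $P$ is Hamiltonian if, in local coordinates, $\{f,h\}=\int \frac{\delta f}{\delta u^i}P^{ij}\frac{\delta h}{\delta u^j}\,dx$ is skew-symmetric and satisfies the Jacobi identity on local functionals of smooth loops $u(x)$. Call $\nabla$ compatible with $g$ if every linear combination $\alpha P_1+\beta P_2$ ($\alpha,\beta\in\mathbb R$) is Hamiltonian. Then there is at most one flat symplectic connection $\nabla$ for $\omega$ that is compatible with $g$. If such a $\nabla$ exists, then in all local coordinates that are flat for $g$ (i.e. in which the $g_{ij}$ are locally constant) it is given by $$c^{ij}_k=g^{js}g_{kr}\frac{\partial\omega^{ir}}{\partial u^s},\qquad\text{and moreover}\qquad c^{ij}_{kl}=c^{ij}_{(k,l)} .$$ -/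

import Mathlib

open scoped Manifold ContDiff

noncomputable section

/-! ## Poisson brackets of differential-geometric type on a loop space

Loops in an open set `U` of `ℝⁿ` are smooth `1`-periodic maps `u : ℝ → ℝⁿ` with values in `U`. -/

namespace LoopSpace

/-- `u` is a smooth loop (a smooth map from the circle `ℝ/ℤ`) with values in `U`. -/
structure IsLoop {n : ℕ} (U : Set (Fin n → ℝ)) (u : ℝ → Fin n → ℝ) : Prop where
  smooth : ContDiff ℝ ∞ u
  periodic : Function.Periodic u 1
  mem : ∀ x, u x ∈ U

/-- The jet `(u, u_x, …, u^{(m)})` of `u` at `x`. -/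
def jet {n : ℕ} (m : ℕ) (u : ℝ → Fin n → ℝ) (x : ℝ) : Fin (m + 1) → Fin n → ℝ :=
  fun s => iteratedDeriv (s : ℕ) u x

/-- A smooth density `f(x, u, u_x, …, u^{(m)})` on the circle, defined for `u ∈ U`. -/
structure Density {n : ℕ} (U : Set (Fin n → ℝ)) where
  /-- the highest derivative of `u` on which the density may depend -/
  order : ℕ
  /-- the density as a function of `x` and of the jet of `u` -/
  toFun : ℝ × (Fin (order + 1) → Fin n → ℝ) → ℝ
  smooth : ContDiffOn ℝ ∞ toFun {p | p.2 0 ∈ U}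
  periodic : ∀ x j, toFun (x + 1, j) = toFun (x, j)

namespace Density

variable {n : ℕ} {U : Set (Fin n → ℝ)}

/-- The local functional `u ↦ ∫ f(x, u, u_x, …) dx` over the circle. -/
def functional (f : Density U) (u : ℝ → Fin n → ℝ) : ℝ :=
  ∫ x in (0 : ℝ)..1, f.toFun (x, jet f.order u x)

/-- The partial derivative `∂f/∂u^i_{(s)}`. -/
def jetDeriv (f : Density U) (s : Fin (f.order + 1)) (i : Fin n)
    (p : ℝ × (Fin (f.order + 1) → Fin n → ℝ)) : ℝ :=
  fderiv ℝ f.toFun p (0, Pi.single s (Pi.single i 1))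

/-- The variational derivative `δf/δu^i = ∑ₛ (-d/dx)^s (∂f/∂u^i_{(s)})` along the loop `u`. -/
def varDeriv (f : Density U) (u : ℝ → Fin n → ℝ) (x : ℝ) (i : Fin n) : ℝ :=
  ∑ s : Fin (f.order + 1), (-1 : ℝ) ^ (s : ℕ) *
    iteratedDeriv (s : ℕ) (fun y => f.jetDeriv s i (y, jet f.order u y)) x

end Density

/-- Matrix operators depending on a loop: `P u ψ x i` is `(P^{ij} ψ_j)(x)` along the loop `u`. -/
abbrev Operator (n : ℕ) : Type :=
  (ℝ → Fin n → ℝ) → (ℝ → Fin n → ℝ) → ℝ → Fin n → ℝ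

/-- The operator `g^{ij}(u) d/dx + b^{ij}_k(u) u^k_x`. -/
def firstOrderOperator {n : ℕ} (g : Fin n → Fin n → (Fin n → ℝ) → ℝ)
    (b : Fin n → Fin n → Fin n → (Fin n → ℝ) → ℝ) : Operator n :=
  fun u ψ x i => ∑ j, (g i j (u x) * deriv ψ x j
    + ∑ k, b i j k (u x) * deriv u x k * ψ x j)

/-- The operator
`a^{ij}(u) (d/dx)² + b^{ij}_k(u) u^k_x d/dx + c^{ij}_{kl}(u) u^k_x u^l_x + c^{ij}_k(u) u^k_{xx}`. -/
def secondOrderOperator {n : ℕ} (a : Fin n → Fin n → (Fin n → ℝ) → ℝ)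
    (b : Fin n → Fin n → Fin n → (Fin n → ℝ) → ℝ)
    (c₂ : Fin n → Fin n → Fin n → Fin n → (Fin n → ℝ) → ℝ)
    (c : Fin n → Fin n → Fin n → (Fin n → ℝ) → ℝ) : Operator n :=
  fun u ψ x i => ∑ j, (a i j (u x) * iteratedDeriv 2 ψ x j
    + ∑ k, b i j k (u x) * deriv u x k * deriv ψ x j
    + ∑ k, ∑ l, c₂ i j k l (u x) * deriv u x k * deriv u x l * ψ x j
    + ∑ k, c i j k (u x) * iteratedDeriv 2 u x k * ψ x j)

/-- The bracket `{f, h} = ∫ (δf/δu^i) P^{ij} (δh/δu^j) dx` of two local functionals. -/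
def bracket {n : ℕ} {U : Set (Fin n → ℝ)} (P : Operator n) (f h : Density U)
    (u : ℝ → Fin n → ℝ) : ℝ :=
  ∫ x in (0 : ℝ)..1, ∑ i, f.varDeriv u x i * P u (h.varDeriv u) x i

/-- `P` is a Hamiltonian operator over `U`: its bracket is skew-symmetric and satisfies the Jacobi
identity on local functionals. In the Jacobi identity `fh`, `hk`, `kf` are densities of the local
functionals `{f, h}`, `{h, k}`, `{k, f}`. -/
structure IsHamiltonian {n : ℕ} (U : Set (Fin n → ℝ)) (P : Operator n) : Prop where
  skew : ∀ (f h : Density U) (u : ℝ → Fin n → ℝ), IsLoop U u →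
    bracket P f h u = -bracket P h f u
  jacobi : ∀ f h k fh hk kf : Density U,
    (∀ u, IsLoop U u → fh.functional u = bracket P f h u) →
    (∀ u, IsLoop U u → hk.functional u = bracket P h k u) →
    (∀ u, IsLoop U u → kf.functional u = bracket P k f u) →
    ∀ u, IsLoop U u → bracket P fh k u + bracket P hk f u + bracket P kf h u = 0

end LoopSpace

/-! ## Metrics, symplectic forms and connections on a manifold

`M` is a smooth manifold modelled on `ℝⁿ`; local coordinates are the charts of its maximal smooth
atlas. -/

namespace TargetGeometry

open LoopSpace

variable {n : ℕ} {M : Type*} [TopologicalSpace M] [ChartedSpace (Fin n → ℝ) M]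

/-- The smooth charts of `M`. -/
abbrev charts (n : ℕ) (M : Type*) [TopologicalSpace M] [ChartedSpace (Fin n → ℝ) M] :
    Set (OpenPartialHomeomorph M (Fin n → ℝ)) :=
  IsManifold.maximalAtlas 𝓘(ℝ, Fin n → ℝ) ∞ M

/-- The coordinate vector field `∂_i` of a chart `φ` (meaningful on the domain of `φ`). -/
def coordField (φ : OpenPartialHomeomorph M (Fin n → ℝ)) (i : Fin n) :
    (p : M) → TangentSpace 𝓘(ℝ, Fin n → ℝ) p :=
  VectorField.mpullback 𝓘(ℝ, Fin n → ℝ) 𝓘(ℝ, Fin n → ℝ) φ (fun _ => Pi.single i 1)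

/-- The components `B_{ij}` in a chart of a field `B` of bilinear forms on the tangent spaces, as
functions of the coordinates. -/
def components
    (B : (p : M) → TangentSpace 𝓘(ℝ, Fin n → ℝ) p →L[ℝ] TangentSpace 𝓘(ℝ, Fin n → ℝ) p →L[ℝ] ℝ)
    (φ : OpenPartialHomeomorph M (Fin n → ℝ)) (i j : Fin n) (y : Fin n → ℝ) : ℝ :=
  B (φ.symm y) (coordField φ i (φ.symm y)) (coordField φ j (φ.symm y))

/-- The components `B^{ij}` of the inverse matrix, `B_{ir} B^{rj} = δ_i^j`. -/
def inverseComponents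
    (B : (p : M) → TangentSpace 𝓘(ℝ, Fin n → ℝ) p →L[ℝ] TangentSpace 𝓘(ℝ, Fin n → ℝ) p →L[ℝ] ℝ)
    (φ : OpenPartialHomeomorph M (Fin n → ℝ)) (i j : Fin n) (y : Fin n → ℝ) : ℝ :=
  (Matrix.of fun r s => components B φ r s y)⁻¹ i j

/-- The partial derivative `∂_i F`. -/
def pd (i : Fin n) (F : (Fin n → ℝ) → ℝ) (y : Fin n → ℝ) : ℝ :=
  fderiv ℝ F y (Pi.single i 1)

/-- The curvature
`R^k_{slt} = ∂_s Γ^k_{lt} - ∂_l Γ^k_{st} + Γ^k_{sr} Γ^r_{lt} - Γ^k_{lr} Γ^r_{st}`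
of Christoffel symbols, where `Γ k i j` stands for `Γ^k_{ij}`. -/
def curvature (Γ : Fin n → Fin n → Fin n → (Fin n → ℝ) → ℝ) (k s l t : Fin n)
    (y : Fin n → ℝ) : ℝ :=
  pd s (Γ k l t) y - pd l (Γ k s t) y + ∑ r, (Γ k s r y * Γ r l t y - Γ k l r y * Γ r s t y)

/-- The contravariant Christoffel symbols `Γ^{ij}_k = -a^{ir} Γ^j_{rk}`. -/
def contravariantSymbols (a : Fin n → Fin n → (Fin n → ℝ) → ℝ)
    (Γ : Fin n → Fin n → Fin n → (Fin n → ℝ) → ℝ) (i j k : Fin n) (y : Fin n → ℝ) : ℝ :=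
  -∑ r, a i r y * Γ j r k y

variable (n M) in
/-- A smooth pseudo-Riemannian metric (of arbitrary signature) on `M`. -/
structure PseudoMetric where
  /-- the bilinear form on each tangent space -/
  form : (p : M) → TangentSpace 𝓘(ℝ, Fin n → ℝ) p →L[ℝ] TangentSpace 𝓘(ℝ, Fin n → ℝ) p →L[ℝ] ℝ
  symm : ∀ p v w, form p v w = form p w v
  nondegenerate : ∀ p v, (∀ w, form p v w = 0) → v = 0
  smooth : ∀ φ ∈ charts n M, ∀ i j, ContDiffOn ℝ ∞ (components form φ i j) φ.target

variable (n M) in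
/-- A symplectic form on `M`: a smooth, closed, non-degenerate two-form. -/
structure SymplecticForm where
  /-- the bilinear form on each tangent space -/
  form : (p : M) → TangentSpace 𝓘(ℝ, Fin n → ℝ) p →L[ℝ] TangentSpace 𝓘(ℝ, Fin n → ℝ) p →L[ℝ] ℝ
  skew : ∀ p v w, form p v w = -form p w v
  nondegenerate : ∀ p v, (∀ w, form p v w = 0) → v = 0
  smooth : ∀ φ ∈ charts n M, ∀ i j, ContDiffOn ℝ ∞ (components form φ i j) φ.target
  closed : ∀ φ ∈ charts n M, ∀ i j k, ∀ y ∈ φ.target,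
    pd i (components form φ j k) y + pd j (components form φ k i) y
      + pd k (components form φ i j) y = 0

/-- The Christoffel symbols
`Γ^k_{ij} = ½ g^{kr} (∂_i g_{rj} + ∂_j g_{ri} - ∂_r g_{ij})`
of the Levi-Civita connection of `g` in a chart. -/
def PseudoMetric.christoffel (g : PseudoMetric n M) (φ : OpenPartialHomeomorph M (Fin n → ℝ))
    (k i j : Fin n) (y : Fin n → ℝ) : ℝ :=
  (1 / 2 : ℝ) * ∑ r, inverseComponents g.form φ k r y *
    (pd i (components g.form φ r j) y + pd j (components g.form φ r i) y
      - pd r (components g.form φ i j) y)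

/-- The metric is flat: the curvature of its Levi-Civita connection vanishes. -/
def PseudoMetric.IsFlat (g : PseudoMetric n M) : Prop :=
  ∀ φ ∈ charts n M, ∀ k s l t, ∀ y ∈ φ.target, curvature (g.christoffel φ) k s l t y = 0

/-- The coordinates of the chart `φ` are flat for `g`: the components `g_{ij}` are locally
constant. -/
def PseudoMetric.IsFlatChart (g : PseudoMetric n M)
    (φ : OpenPartialHomeomorph M (Fin n → ℝ)) : Prop :=
  ∀ i j k, ∀ y ∈ φ.target, pd k (components g.form φ i j) y = 0

/-- The operator of hydrodynamic type `g^{ij} d/dx + Γ^{ij}_k u^k_x`, `Γ^{ij}_k = -g^{ir} Γ^j_{rk}`,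
of the metric `g`, in a chart. -/
def PseudoMetric.hydrodynamicOperator (g : PseudoMetric n M)
    (φ : OpenPartialHomeomorph M (Fin n → ℝ)) : Operator n :=
  firstOrderOperator (inverseComponents g.form φ)
    (contravariantSymbols (inverseComponents g.form φ) (g.christoffel φ))

/-- Connections on the tangent bundle of `M`. -/
abbrev Connection (n : ℕ) (M : Type*) [TopologicalSpace M] [ChartedSpace (Fin n → ℝ) M]
    [IsManifold 𝓘(ℝ, Fin n → ℝ) ∞ M] : Type _ :=
  CovariantDerivative 𝓘(ℝ, Fin n → ℝ) (Fin n → ℝ) (TangentSpace 𝓘(ℝ, Fin n → ℝ) : M → Type _)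

variable [IsManifold 𝓘(ℝ, Fin n → ℝ) ∞ M]

/-- The Christoffel symbols `Γ^k_{ij}` of a connection in a chart, `∇_{∂_i} ∂_j = Γ^k_{ij} ∂_k`. -/
def christoffel (D : Connection n M) (φ : OpenPartialHomeomorph M (Fin n → ℝ))
    (k i j : Fin n) (y : Fin n → ℝ) : ℝ :=
  (mfderiv 𝓘(ℝ, Fin n → ℝ) 𝓘(ℝ, Fin n → ℝ) φ (φ.symm y)
    (D (coordField φ j) (φ.symm y) (coordField φ i (φ.symm y))) : Fin n → ℝ) k

/-- The vector field `X` on `M`, as a section of the tangent bundle, is differentiable at `p`. -/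
abbrev IsDifferentiableAt (X : (p : M) → TangentSpace 𝓘(ℝ, Fin n → ℝ) p) (p : M) : Prop :=
  MDifferentiableAt 𝓘(ℝ, Fin n → ℝ) (𝓘(ℝ, Fin n → ℝ).prod 𝓘(ℝ, Fin n → ℝ))
    (fun q => Bundle.TotalSpace.mk' (Fin n → ℝ) q (X q)) p

/-- `D` is a flat symplectic connection for `Ω`: a smooth torsion-free connection with `∇Ω = 0`, i.e.
`v(Ω(Y, Z)) = Ω(∇_v Y, Z) + Ω(Y, ∇_v Z)`,
and vanishing curvature. -/
structure IsFlatSymplecticConnection (Ω : SymplecticForm n M) (D : Connection n M) : Prop where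
  smooth : ∀ φ ∈ charts n M, ∀ k i j, ContDiffOn ℝ ∞ (christoffel D φ k i j) φ.target
  torsion_free : D.torsion = 0
  parallel : ∀ (Y Z : (p : M) → TangentSpace 𝓘(ℝ, Fin n → ℝ) p) (p : M),
    IsDifferentiableAt Y p → IsDifferentiableAt Z p → ∀ v : TangentSpace 𝓘(ℝ, Fin n → ℝ) p,
      mvfderiv 𝓘(ℝ, Fin n → ℝ) (fun q => Ω.form q (Y q) (Z q)) p v
        = Ω.form p (D Y p v) (Z p) + Ω.form p (Y p) (D Z p v)
  flat : ∀ φ ∈ charts n M, ∀ k s l t, ∀ y ∈ φ.target, curvature (christoffel D φ) k s l t y = 0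

/-- The contravariant Christoffel symbols `c^{ij}_k = -Ω^{ir} Γ^j_{rk}` of a connection `D`, the
index being raised with the inverse `Ω^{ij}` of the symplectic form. -/
def symplecticSymbols (Ω : SymplecticForm n M) (D : Connection n M)
    (φ : OpenPartialHomeomorph M (Fin n → ℝ)) : Fin n → Fin n → Fin n → (Fin n → ℝ) → ℝ :=
  contravariantSymbols (inverseComponents Ω.form φ) (christoffel D φ)

/-- The symmetrised derivative `c^{ij}_{(k,l)} = ½ (∂_l c^{ij}_k + ∂_k c^{ij}_l)`. -/
def symDeriv (c : Fin n → Fin n → Fin n → (Fin n → ℝ) → ℝ) (i j k l : Fin n)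
    (y : Fin n → ℝ) : ℝ :=
  (1 / 2 : ℝ) * (pd l (c i j k) y + pd k (c i j l) y)

/-- The coefficients `c^{ij}_{kl} = c^{ij}_{(k,l)} - Ω_{pr} c^{ri}_{(k} c^{pj}_{l)}`, where
round brackets on indices denote symmetrisation in `k` and `l`. -/
def quadraticCoefficient (Ω : SymplecticForm n M) (D : Connection n M)
    (φ : OpenPartialHomeomorph M (Fin n → ℝ)) (i j k l : Fin n) (y : Fin n → ℝ) : ℝ :=
  symDeriv (symplecticSymbols Ω D φ) i j k l y
    - ∑ p, ∑ r, components Ω.form φ p r y * ((1 / 2 : ℝ) *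
      (symplecticSymbols Ω D φ r i k y * symplecticSymbols Ω D φ p j l y
        + symplecticSymbols Ω D φ r i l y * symplecticSymbols Ω D φ p j k y))

/-- The operator of degree two
`Ω^{ij} (d/dx)² + 2 c^{ij}_k u^k_x d/dx + c^{ij}_{kl} u^k_x u^l_x + c^{ij}_k u^k_{xx}`
specified by `(Ω, D)`, in a chart. -/
def degreeTwoOperator (Ω : SymplecticForm n M) (D : Connection n M)
    (φ : OpenPartialHomeomorph M (Fin n → ℝ)) : Operator n :=
  secondOrderOperator (inverseComponents Ω.form φ)
    (fun i j k y => 2 * symplecticSymbols Ω D φ i j k y)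
    (quadraticCoefficient Ω D φ) (symplecticSymbols Ω D φ)

/-- The degree two operator of `(Ω, D)` is compatible with the hydrodynamic operator of `g`: in
local coordinates every linear combination of the two operators is Hamiltonian. -/
def AreCompatible (g : PseudoMetric n M) (Ω : SymplecticForm n M) (D : Connection n M) : Prop :=
  ∀ φ ∈ charts n M, ∀ α β : ℝ,
    IsHamiltonian φ.target (α • g.hydrodynamicOperator φ + β • degreeTwoOperator Ω D φ)

end TargetGeometry

end

/-! Only linear functionals `∫ a_i(x) u^i dx` are needed. Their variational derivative is the test
field `a`, independent of `u`. The bracket of two of them is `∫ a_i P^{ij} b_j dx`, and bracketing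
that with a third is the derivative of this integral in the direction `P c` (`bracket_pairDensity`).
The Jacobi identity thus says that a trilinear quantity in the test fields `a`, `b`, `c` has
vanishing cyclic sum; skew-symmetry says that it changes sign under `a ↔ b`. Applied to `P₁`, `P₂`
and `P₁ + P₂`, both relations pass to the part bilinear in `P₁` and `P₂` (`cyclic_mixedPairing`,
`mixedPairing_swap`).

At a constant loop `u = y` the derivative of `P₁` along `P₂ c` sees only the leading coefficient of
`P₂`, while the derivative of `P₂` along `P₁ c` is an integral of third order whose coefficients are
`A^{ijk} = g^{mk} ∂_m ω^{ij}`, `2 C^{ijk}` and `C^{ijk}`, with `C^{ijk} = c^{ij}_m g^{mk}`.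
Trigonometric test functions turn the relations into linear algebra.

Uniqueness (`coefficient_unique`): for two solutions with the same `g` and `ω`, the difference `D`
of the tensors `C` satisfies `D^{ijk} = -D^{kij}`. Three rotations give `D = -D`, hence `D = 0`. As
`g` and `ω` are invertible, the Christoffel symbols agree, and so do the connections.

Formula for `c^{ij}_k` (`coefficient_eq`): in flat coordinates `P₁ = g d/dx` has locally constant
coefficients, so the derivative of `P₁` vanishes. Frequency one gives `A^{ijk} = C^{ijk} + C^{kij} =
C^{ijk} - C^{jik}`, so `C` is skew in its outer indices; adding frequency two gives `C^{ijk} +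
C^{jki} + C^{kij} = 0`. Together these yield `C^{ijk} = A^{ikj}`, which is the formula with an index
raised.

Formula for `c^{ij}_{kl}` (`quadratic_form_eq`): constant `a` and `b` leave only the variation of `∫
(c_{kl} u^k_x u^l_x + c_k u^k_{xx}) dx` in the cyclic sum, so it must vanish. Integrating by parts
and testing on small oscillations about `y` gives `c_{kl} e^k e^l = (∂_l c_k) e^k e^l`; polarisation
finishes, because `c_{kl}` is symmetric. -/

namespace LoopSpace

/-! ### Smooth periodic functions and the first variation of local functionals -/

/-- A smooth `1`-periodic function on the line. -/
structure SmoothPeriodic {E : Type*} [NormedAddCommGroup E] [NormedSpace ℝ E] (f : ℝ → E) :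
    Prop where
  smooth : ContDiff ℝ ∞ f
  periodic : Function.Periodic f 1

namespace SmoothPeriodic

variable {E : Type*} [NormedAddCommGroup E] [NormedSpace ℝ E]

theorem deriv {f : ℝ → E} (hf : SmoothPeriodic f) : SmoothPeriodic (deriv f) where
  smooth := (contDiff_infty_iff_deriv.1 hf.smooth).2
  periodic x := by
    rw [← deriv_comp_add_const, show (fun y => f (y + 1)) = f from funext hf.periodic]

theorem iteratedDeriv {f : ℝ → E} (hf : SmoothPeriodic f) (s : ℕ) :
    SmoothPeriodic (iteratedDeriv s f) := by
  induction s with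
  | zero => simpa using hf
  | succ s ih => rw [iteratedDeriv_succ]; exact ih.deriv

theorem differentiable {f : ℝ → E} (hf : SmoothPeriodic f) : Differentiable ℝ f :=
  hf.smooth.differentiable (by simp)

theorem continuous {f : ℝ → E} (hf : SmoothPeriodic f) : Continuous f :=
  hf.smooth.continuous

theorem coord {n : ℕ} {f : ℝ → Fin n → ℝ} (hf : SmoothPeriodic f) (i : Fin n) :
    SmoothPeriodic (fun x => f x i) where
  smooth := contDiff_pi.1 hf.smooth i
  periodic x := congrFun (hf.periodic x) i

theorem pi {ι : Type*} [Fintype ι] {f : ℝ → ι → E} (hf : ∀ i, SmoothPeriodic (fun x => f x i)) :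
    SmoothPeriodic f where
  smooth := contDiff_pi.2 fun i => (hf i).smooth
  periodic x := funext fun i => (hf i).periodic x

theorem const (c : E) : SmoothPeriodic (fun _ : ℝ => c) := ⟨contDiff_const, fun _ => rfl⟩

theorem smul_const {f : ℝ → ℝ} (hf : SmoothPeriodic f) (c : E) :
    SmoothPeriodic (fun x => f x • c) :=
  ⟨hf.smooth.smul contDiff_const, fun x => by simp only [hf.periodic x]⟩

theorem integral_deriv_mul {f g : ℝ → ℝ} (hf : SmoothPeriodic f) (hg : SmoothPeriodic g) :
    ∫ x in (0 : ℝ)..1, _root_.deriv f x * g x = -∫ x in (0 : ℝ)..1, f x * _root_.deriv g x := by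
  have h := intervalIntegral.integral_mul_deriv_eq_deriv_mul (a := 0) (b := 1)
    (fun x _ => (hf.differentiable x).hasDerivAt) (fun x _ => (hg.differentiable x).hasDerivAt)
    (hf.deriv.continuous.intervalIntegrable _ _) (hg.deriv.continuous.intervalIntegrable _ _)
  have h₁ : f 1 = f 0 := by simpa using hf.periodic 0
  have h₂ : g 1 = g 0 := by simpa using hg.periodic 0
  rw [h, h₁, h₂]
  ring

theorem integral_iteratedDeriv_mul {f g : ℝ → ℝ} (hf : SmoothPeriodic f) (hg : SmoothPeriodic g)
    (s : ℕ) : ∫ x in (0 : ℝ)..1, (-1 : ℝ) ^ s * _root_.iteratedDeriv s f x * g x =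
      ∫ x in (0 : ℝ)..1, f x * _root_.iteratedDeriv s g x := by
  induction s generalizing f with
  | zero => simp
  | succ s ih =>
    have h := ih hf.deriv
    rw [hf.integral_deriv_mul (hg.iteratedDeriv s)] at h
    simp only [iteratedDeriv_succ (n := s) (f := g)]
    rw [eq_neg_iff_add_eq_zero, add_comm, ← eq_neg_iff_add_eq_zero] at h
    rw [h, ← intervalIntegral.integral_neg]
    congr 1
    ext x
    rw [iteratedDeriv_succ']
    ring

end SmoothPeriodic

theorem iteratedDeriv_apply_pi {n : ℕ} {f : ℝ → Fin n → ℝ} (hf : ContDiff ℝ ∞ f) (s : ℕ) (x : ℝ)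
    (i : Fin n) : iteratedDeriv s f x i = iteratedDeriv s (fun y => f y i) x := by
  induction s generalizing x with
  | zero => simp
  | succ s ih =>
    have hd : ∀ i, DifferentiableAt ℝ (fun y => iteratedDeriv s f y i) x := by
      refine differentiableAt_pi.1 ?_
      exact (hf.differentiable_iteratedDeriv s (by exact_mod_cast ENat.natCast_lt_top s)) x
    rw [iteratedDeriv_succ, iteratedDeriv_succ, deriv_pi hd]
    exact congrArg (fun F => deriv F x) (funext fun y => ih y)

theorem IsLoop.smoothPeriodic {n : ℕ} {U : Set (Fin n → ℝ)} {u : ℝ → Fin n → ℝ} (hu : IsLoop U u) :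
    SmoothPeriodic u := ⟨hu.smooth, hu.periodic⟩

theorem SmoothPeriodic.jet {n : ℕ} {u : ℝ → Fin n → ℝ} (hu : SmoothPeriodic u) (m : ℕ) :
    SmoothPeriodic (jet m u) :=
  SmoothPeriodic.pi fun s => hu.iteratedDeriv s

theorem jet_zero {n m : ℕ} (u : ℝ → Fin n → ℝ) (x : ℝ) : jet m u x 0 = u x := by
  simp [jet]

theorem isOpen_jetDomain {n m : ℕ} {U : Set (Fin n → ℝ)} (hU : IsOpen U) :
    IsOpen {p : ℝ × (Fin (m + 1) → Fin n → ℝ) | p.2 0 ∈ U} :=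
  hU.preimage ((continuous_apply 0).comp continuous_snd)

variable {n : ℕ} {U : Set (Fin n → ℝ)}

theorem Density.jetDeriv_smoothPeriodic (hU : IsOpen U) (f : Density U) (s : Fin (f.order + 1))
    (i : Fin n) {u : ℝ → Fin n → ℝ} (hu : IsLoop U u) :
    SmoothPeriodic (fun y => f.jetDeriv s i (y, jet f.order u y)) where
  smooth := by
    have h : ContDiffOn ℝ ∞ (fderiv ℝ f.toFun) {p | p.2 0 ∈ U} :=
      f.smooth.fderiv_of_isOpen (isOpen_jetDomain hU) (by simp)
    have h₂ : ContDiff ℝ ∞ (fun y => fderiv ℝ f.toFun (y, LoopSpace.jet f.order u y)) :=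
      h.comp_contDiff (contDiff_id.prodMk (hu.smoothPeriodic.jet _).smooth)
        fun y => by simpa [jet_zero] using hu.mem y
    exact h₂.clm_apply contDiff_const
  periodic y := by
    -- The density is invariant under translation by `(1, 0)`, hence so is its derivative.
    have h := fderiv_comp_add_right (𝕜 := ℝ) (f := f.toFun) (x := (y, LoopSpace.jet f.order u y))
      ((1 : ℝ), (0 : Fin (f.order + 1) → Fin n → ℝ))
    have h₂ : (fun p : ℝ × (Fin (f.order + 1) → Fin n → ℝ) =>
        f.toFun (p + ((1 : ℝ), (0 : Fin (f.order + 1) → Fin n → ℝ)))) = f.toFun := by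
      ext ⟨x, j⟩
      simpa using f.periodic x j
    rw [h₂] at h
    have h₃ : LoopSpace.jet f.order u (y + 1) = LoopSpace.jet f.order u y :=
      (hu.smoothPeriodic.jet _).periodic y
    simp only [Density.jetDeriv, h₃]
    rw [h]
    simp

theorem sum_single_single {m : ℕ} (V : Fin m → Fin n → ℝ) :
    ∑ s, ∑ i, V s i • (Pi.single s (Pi.single i 1) : Fin m → Fin n → ℝ) = V := by
  ext t k
  simp only [Finset.sum_apply, Pi.smul_apply, smul_eq_mul]
  rw [Finset.sum_eq_single t, Finset.sum_eq_single k]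
  · simp
  · intro i _ hi
    simp [hi.symm]
  · simp
  · intro s _ hs
    refine Finset.sum_eq_zero fun i _ => ?_
    simp [hs.symm]
  · simp

/-- The first variation formula. -/
theorem Density.integral_varDeriv_mul (hU : IsOpen U) (f : Density U) {u V : ℝ → Fin n → ℝ}
    (hu : IsLoop U u) (hV : SmoothPeriodic V) :
    ∫ x in (0 : ℝ)..1, ∑ i, f.varDeriv u x i * V x i =
      ∫ x in (0 : ℝ)..1, fderiv ℝ f.toFun (x, jet f.order u x) (0, jet f.order V x) := by
  have hA := fun s i => f.jetDeriv_smoothPeriodic hU s i hu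
  have h₁ : ∀ x, fderiv ℝ f.toFun (x, LoopSpace.jet f.order u x) (0, LoopSpace.jet f.order V x) =
      ∑ i, ∑ s : Fin (f.order + 1), f.jetDeriv s i (x, LoopSpace.jet f.order u x) *
        iteratedDeriv (s : ℕ) (fun y => V y i) x := by
    intro x
    have h : ((0 : ℝ), LoopSpace.jet f.order V x) = ∑ s, ∑ i, LoopSpace.jet f.order V x s i •
        ((0 : ℝ), (Pi.single s (Pi.single i 1) : Fin (f.order + 1) → Fin n → ℝ)) := by
      conv_lhs => rw [← sum_single_single (LoopSpace.jet f.order V x)]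
      ext <;> simp [Prod.fst_sum, Prod.snd_sum]
    rw [h]
    simp only [map_sum, map_smul, smul_eq_mul]
    rw [Finset.sum_comm]
    refine Finset.sum_congr rfl fun i _ => Finset.sum_congr rfl fun s _ => ?_
    rw [← iteratedDeriv_apply_pi hV.smooth, mul_comm]
    rfl
  have h₂ : ∀ x, ∑ i, f.varDeriv u x i * V x i = ∑ i, ∑ s : Fin (f.order + 1),
      (-1 : ℝ) ^ (s : ℕ) * iteratedDeriv (s : ℕ)
        (fun y => f.jetDeriv s i (y, LoopSpace.jet f.order u y)) x * V x i := by
    intro x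
    simp only [Density.varDeriv, Finset.sum_mul]
  simp only [h₁, h₂]
  rw [intervalIntegral.integral_finsetSum, intervalIntegral.integral_finsetSum]
  · refine Finset.sum_congr rfl fun i _ => ?_
    rw [intervalIntegral.integral_finsetSum, intervalIntegral.integral_finsetSum]
    · exact Finset.sum_congr rfl fun s _ => (hA s i).integral_iteratedDeriv_mul (hV.coord i) s
    · exact fun s _ => Continuous.intervalIntegrable
        ((hA s i).continuous.mul ((hV.coord i).iteratedDeriv s).continuous) _ _
    · exact fun s _ => Continuous.intervalIntegrable ((continuous_const.mul
        ((hA s i).iteratedDeriv s).continuous).mul (hV.coord i).continuous) _ _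
  · exact fun i _ => Continuous.intervalIntegrable (continuous_finsetSum _ fun s _ =>
      (hA s i).continuous.mul ((hV.coord i).iteratedDeriv s).continuous) _ _
  · exact fun i _ => Continuous.intervalIntegrable (continuous_finsetSum _ fun s _ =>
      (continuous_const.mul ((hA s i).iteratedDeriv s).continuous).mul
        (hV.coord i).continuous) _ _

end LoopSpace

namespace LoopSpace

/-! ### The Jacobi identity on linear functionals -/

/-- The space of `2`-jets of maps `ℝ → ℝⁿ`. -/
abbrev Jet₂ (n : ℕ) : Type := Fin (2 + 1) → Fin n → ℝ

/-- Symbols of second order operators: functions of the `2`-jets of the loop and of the argument. -/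
abbrev JetSymbol (n : ℕ) : Type := Jet₂ n → Jet₂ n → Fin n → ℝ

variable {n : ℕ} {U : Set (Fin n → ℝ)}

theorem IsLoop.jet_mem {u : ℝ → Fin n → ℝ} (hu : IsLoop U u) (m : ℕ) (x : ℝ) :
    jet m u x 0 ∈ U := by
  simpa [jet_zero] using hu.mem x

/-- The operator with a given symbol. -/
noncomputable def jetOperator (Φ : JetSymbol n) : Operator n := fun u ψ x => Φ (jet 2 u x) (jet 2 ψ x)

/-- The symbol is smooth for loops with values in `U`. -/
def SmoothSymbol (U : Set (Fin n → ℝ)) (Φ : JetSymbol n) : Prop :=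
  ContDiffOn ℝ ∞ (fun p : Jet₂ n × Jet₂ n => Φ p.1 p.2) {p | p.1 0 ∈ U}

theorem SmoothSymbol.add {Φ Ψ : JetSymbol n} (hΦ : SmoothSymbol U Φ) (hΨ : SmoothSymbol U Ψ) :
    SmoothSymbol U (Φ + Ψ) :=
  ContDiffOn.add hΦ hΨ

theorem isOpen_symbolDomain (hU : IsOpen U) : IsOpen {p : Jet₂ n × Jet₂ n | p.1 0 ∈ U} :=
  hU.preimage ((continuous_apply 0).comp continuous_fst)

theorem SmoothSymbol.smoothPeriodic {Φ : JetSymbol n} (hΦ : SmoothSymbol U Φ)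
    {u c : ℝ → Fin n → ℝ} (hu : IsLoop U u) (hc : SmoothPeriodic c) :
    SmoothPeriodic (fun x => Φ (jet 2 u x) (jet 2 c x)) where
  smooth := hΦ.comp_contDiff ((hu.smoothPeriodic.jet 2).smooth.prodMk (hc.jet 2).smooth)
    fun x => hu.jet_mem 2 x
  periodic x := by
    simp only [(hu.smoothPeriodic.jet 2).periodic x, (hc.jet 2).periodic x]

theorem SmoothSymbol.differentiableAt (hU : IsOpen U) {Φ : JetSymbol n} (hΦ : SmoothSymbol U Φ)
    {j : Jet₂ n} (hj : j 0 ∈ U) (η : Jet₂ n) : DifferentiableAt ℝ (fun j => Φ j η) j := by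
  have h : DifferentiableAt ℝ (fun p : Jet₂ n × Jet₂ n => Φ p.1 p.2) (j, η) :=
    (hΦ.contDiffAt ((isOpen_symbolDomain hU).mem_nhds hj)).differentiableAt (by simp)
  exact h.comp (f := fun j => (j, η)) j (differentiableAt_id.prodMk (differentiableAt_const η))

/-- The derivative in the loop jet alone is the joint derivative restricted to `(ξ, 0)`. The joint
form makes it visibly continuous when both jets vary with `x`. -/
theorem SmoothSymbol.fderiv_eq (hU : IsOpen U) {Φ : JetSymbol n} (hΦ : SmoothSymbol U Φ)
    {j : Jet₂ n} (hj : j 0 ∈ U) (η ξ : Jet₂ n) : fderiv ℝ (fun j => Φ j η) j ξ =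
      fderiv ℝ (fun p : Jet₂ n × Jet₂ n => Φ p.1 p.2) (j, η) (ξ, 0) := by
  have h : DifferentiableAt ℝ (fun p : Jet₂ n × Jet₂ n => Φ p.1 p.2) (j, η) :=
    (hΦ.contDiffAt ((isOpen_symbolDomain hU).mem_nhds hj)).differentiableAt (by simp)
  have h₂ := h.hasFDerivAt.comp (f := fun j => (j, η)) j
    ((hasFDerivAt_id (𝕜 := ℝ) j).prodMk (hasFDerivAt_const (𝕜 := ℝ) η j))
  have h₃ := h₂.fderiv
  rw [show ((fun p : Jet₂ n × Jet₂ n => Φ p.1 p.2) ∘ fun j => (j, η)) = fun j => Φ j η from rfl]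
    at h₃
  rw [h₃]
  simp

/-- The density of the linear functional `u ↦ ∫ a_i(x) u^i dx`. -/
def linearDensity (U : Set (Fin n → ℝ)) {a : ℝ → Fin n → ℝ} (ha : SmoothPeriodic a) :
    Density U where
  order := 0
  toFun p := ∑ i, a p.1 i * p.2 0 i
  smooth := by
    refine ContDiff.contDiffOn (ContDiff.sum fun i _ => ?_)
    exact ((contDiff_pi.1 ha.smooth i).comp contDiff_fst).mul (by fun_prop)
  periodic x j := by simp only [ha.periodic x]

/-- This makes linear functionals good probes: every smooth periodic field occurs as a variational
derivative, whatever the loop. -/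
theorem varDeriv_linearDensity {a : ℝ → Fin n → ℝ} (ha : SmoothPeriodic a) (u : ℝ → Fin n → ℝ) :
    (linearDensity U ha).varDeriv u = a := by
  have key : ∀ (p : ℝ × (Fin (0 + 1) → Fin n → ℝ)) (i : Fin n),
      fderiv ℝ (fun p : ℝ × (Fin (0 + 1) → Fin n → ℝ) => ∑ i, a p.1 i * p.2 0 i) p
        (0, Pi.single 0 (Pi.single i 1)) = a p.1 i := by
    intro p i
    have hd : DifferentiableAt ℝ
        (fun p : ℝ × (Fin (0 + 1) → Fin n → ℝ) => ∑ i, a p.1 i * p.2 0 i) p :=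
      (((linearDensity Set.univ ha).smooth).contDiffAt (by simp)).differentiableAt (by simp)
    -- The density is affine along the line in question, so the line derivative can be read off.
    rw [← hd.lineDeriv_eq_fderiv, lineDeriv]
    have h : ∀ t : ℝ, ∑ k, a (p + t • ((0 : ℝ),
        (Pi.single 0 (Pi.single i 1) : Fin (0 + 1) → Fin n → ℝ))).1 k *
        (p + t • ((0 : ℝ), (Pi.single 0 (Pi.single i 1) : Fin (0 + 1) → Fin n → ℝ))).2 0 k =
        ∑ k, a p.1 k * p.2 0 k + t * a p.1 i := by
      intro t
      simp [mul_add, Finset.sum_add_distrib, Pi.single_apply, mul_comm]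
    simp only [h]
    simp
  ext x i
  change ∑ s : Fin (0 + 1), (-1 : ℝ) ^ (s : ℕ) * iteratedDeriv (s : ℕ)
    (fun y => fderiv ℝ (fun p : ℝ × (Fin (0 + 1) → Fin n → ℝ) => ∑ i, a p.1 i * p.2 0 i)
      (y, jet 0 u y) (0, Pi.single s (Pi.single i 1))) x = a x i
  rw [Fin.sum_univ_one]
  simpa using key (x, jet 0 u x) i

/-- The density `a_i P^{ij} b_j` of the bracket of two linear functionals. -/
noncomputable def pairDensity {Φ : JetSymbol n} (hΦ : SmoothSymbol U Φ) {a b : ℝ → Fin n → ℝ}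
    (ha : SmoothPeriodic a) (hb : SmoothPeriodic b) : Density U where
  order := 2
  toFun p := ∑ i, a p.1 i * Φ p.2 (jet 2 b p.1) i
  smooth := by
    refine ContDiffOn.sum fun i _ => ?_
    refine ((contDiff_pi.1 ha.smooth i).comp contDiff_fst).contDiffOn.mul ?_
    have h : ContDiffOn ℝ ∞ (fun p : ℝ × Jet₂ n => Φ p.2 (jet 2 b p.1)) {p | p.2 0 ∈ U} :=
      hΦ.comp (contDiff_snd.prodMk ((hb.jet 2).smooth.comp contDiff_fst)).contDiffOn
        fun p hp => hp
    exact contDiffOn_pi.1 h i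
  periodic x j := by simp only [ha.periodic x, (hb.jet 2).periodic x]

/-- The negative of a density. -/
def Density.neg (f : Density U) : Density U where
  order := f.order
  toFun p := -f.toFun p
  smooth := f.smooth.neg
  periodic x j := by simp only [f.periodic x j]

theorem functional_neg (f : Density U) (u : ℝ → Fin n → ℝ) :
    f.neg.functional u = -f.functional u := by
  simp [Density.functional, Density.neg]

theorem functional_pairDensity {Φ : JetSymbol n} (hΦ : SmoothSymbol U Φ) {a b : ℝ → Fin n → ℝ}
    (ha : SmoothPeriodic a) (hb : SmoothPeriodic b) (u : ℝ → Fin n → ℝ) :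
    (pairDensity hΦ ha hb).functional u =
      bracket (jetOperator Φ) (linearDensity U ha) (linearDensity U hb) u := by
  simp only [bracket, varDeriv_linearDensity]
  rfl

/-- The derivative of `∫ a_i P^{ij} b_j dx` in the direction `Q c`, for operators `P` and `Q` with
symbols `Φ` and `Ψ`. -/
noncomputable def variationPairing (Φ Ψ : JetSymbol n) (a b c u : ℝ → Fin n → ℝ) : ℝ :=
  ∫ x in (0 : ℝ)..1, ∑ i, a x i * fderiv ℝ (fun j => Φ j (jet 2 b x)) (jet 2 u x)
    (jet 2 (fun y => Ψ (jet 2 u y) (jet 2 c y)) x) i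

theorem fderiv_pairDensity (hU : IsOpen U) {Φ : JetSymbol n} (hΦ : SmoothSymbol U Φ)
    {a b : ℝ → Fin n → ℝ} (ha : SmoothPeriodic a) (hb : SmoothPeriodic b) (x : ℝ) {j : Jet₂ n}
    (hj : j 0 ∈ U) (ξ : Jet₂ n) : fderiv ℝ (pairDensity hΦ ha hb).toFun (x, j) (0, ξ) =
      ∑ i, a x i * fderiv ℝ (fun j => Φ j (jet 2 b x)) j ξ i := by
  have hd : DifferentiableAt ℝ (pairDensity hΦ ha hb).toFun (x, j) :=
    ((pairDensity hΦ ha hb).smooth.contDiffAt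
      ((isOpen_jetDomain hU).mem_nhds hj)).differentiableAt (by simp)
  have h₁ := hd.hasFDerivAt.comp (f := fun j => (x, j)) j
    ((hasFDerivAt_const (𝕜 := ℝ) x j).prodMk (hasFDerivAt_id (𝕜 := ℝ) j))
  have h₂ : HasFDerivAt (fun j : Jet₂ n => ∑ i, a x i * Φ j (jet 2 b x) i)
      (∑ i, a x i • (ContinuousLinearMap.proj i).comp
        (fderiv ℝ (fun j => Φ j (jet 2 b x)) j)) j := by
    refine HasFDerivAt.fun_sum fun i _ => ?_
    refine HasFDerivAt.const_mul ?_ _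
    exact (hasFDerivAt_pi'.1 (hΦ.differentiableAt hU hj (jet 2 b x)).hasFDerivAt) i
  have h₃ := congrArg (fun L => L ξ) (h₁.unique h₂)
  exact Eq.trans rfl (h₃.trans (by simp))

/-- The first variation formula with `V = P c` replaces the variational derivative of the pair
density by a directional derivative of the symbol. -/
theorem bracket_pairDensity (hU : IsOpen U) {Φ : JetSymbol n} (hΦ : SmoothSymbol U Φ)
    {a b c u : ℝ → Fin n → ℝ} (ha : SmoothPeriodic a) (hb : SmoothPeriodic b)
    (hc : SmoothPeriodic c) (hu : IsLoop U u) :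
    bracket (jetOperator Φ) (pairDensity hΦ ha hb) (linearDensity U hc) u =
      variationPairing Φ Φ a b c u := by
  have h := (pairDensity hΦ ha hb).integral_varDeriv_mul hU hu (hΦ.smoothPeriodic hu hc)
  simp only [bracket, varDeriv_linearDensity]
  refine h.trans (intervalIntegral.integral_congr fun x _ => ?_)
  exact fderiv_pairDensity hU hΦ ha hb x (hu.jet_mem 2 x) _

theorem bracket_neg_pairDensity (hU : IsOpen U) {Φ : JetSymbol n} (hΦ : SmoothSymbol U Φ)
    {a b c u : ℝ → Fin n → ℝ} (ha : SmoothPeriodic a) (hb : SmoothPeriodic b)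
    (hc : SmoothPeriodic c) (hu : IsLoop U u) :
    bracket (jetOperator Φ) (pairDensity hΦ ha hb).neg (linearDensity U hc) u =
      -variationPairing Φ Φ a b c u := by
  have h := (pairDensity hΦ ha hb).neg.integral_varDeriv_mul hU hu (hΦ.smoothPeriodic hu hc)
  simp only [bracket, varDeriv_linearDensity]
  refine h.trans ?_
  rw [variationPairing, ← intervalIntegral.integral_neg]
  refine intervalIntegral.integral_congr fun x _ => ?_
  have h₂ := fderiv_pairDensity hU hΦ ha hb x (j := jet 2 u x)
    (hu.jet_mem 2 x) (jet 2 (fun y => Φ (jet 2 u y) (jet 2 c y)) x)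
  simp only [← h₂]
  exact congrArg (fun L : ℝ × Jet₂ n →L[ℝ] ℝ => L (0, jet 2 (fun y => Φ (jet 2 u y) (jet 2 c y)) x))
    (fderiv_fun_neg (𝕜 := ℝ) (f := (pairDensity hΦ ha hb).toFun) (x := (x, jet 2 u x)))

/-! ### Cyclic and exchange relations, and their polarisation -/

theorem IsHamiltonian.cyclic_variationPairing (hU : IsOpen U) {Φ : JetSymbol n}
    (hΦ : SmoothSymbol U Φ) (hP : IsHamiltonian U (jetOperator Φ)) {a b c u : ℝ → Fin n → ℝ}
    (ha : SmoothPeriodic a) (hb : SmoothPeriodic b) (hc : SmoothPeriodic c) (hu : IsLoop U u) :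
    variationPairing Φ Φ a b c u + variationPairing Φ Φ b c a u
      + variationPairing Φ Φ c a b u = 0 := by
  have h := hP.jacobi (linearDensity U ha) (linearDensity U hb) (linearDensity U hc)
    (pairDensity hΦ ha hb) (pairDensity hΦ hb hc) (pairDensity hΦ hc ha)
    (fun u _ => functional_pairDensity hΦ ha hb u) (fun u _ => functional_pairDensity hΦ hb hc u)
    (fun u _ => functional_pairDensity hΦ hc ha u) u hu
  rwa [bracket_pairDensity hU hΦ ha hb hc hu, bracket_pairDensity hU hΦ hb hc ha hu,
    bracket_pairDensity hU hΦ hc ha hb hu] at h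

/-- By skew-symmetry, minus the density for `(b, a)` is another density of the functional `{a, b}`.
The Jacobi identity holds for either choice, and comparing the two isolates the first term. -/
theorem IsHamiltonian.variationPairing_swap (hU : IsOpen U) {Φ : JetSymbol n}
    (hΦ : SmoothSymbol U Φ) (hP : IsHamiltonian U (jetOperator Φ)) {a b c u : ℝ → Fin n → ℝ}
    (ha : SmoothPeriodic a) (hb : SmoothPeriodic b) (hc : SmoothPeriodic c) (hu : IsLoop U u) :
    variationPairing Φ Φ a b c u + variationPairing Φ Φ b a c u = 0 := by
  have h₁ := hP.cyclic_variationPairing hU hΦ ha hb hc hu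
  have h := hP.jacobi (linearDensity U ha) (linearDensity U hb) (linearDensity U hc)
    (pairDensity hΦ hb ha).neg (pairDensity hΦ hb hc) (pairDensity hΦ hc ha)
    (fun u hu => by rw [functional_neg, functional_pairDensity, hP.skew _ _ u hu, neg_neg])
    (fun u _ => functional_pairDensity hΦ hb hc u)
    (fun u _ => functional_pairDensity hΦ hc ha u) u hu
  rw [bracket_neg_pairDensity hU hΦ hb ha hc hu, bracket_pairDensity hU hΦ hb hc ha hu,
    bracket_pairDensity hU hΦ hc ha hb hu] at h
  linarith

theorem continuous_variationPairing_integrand (hU : IsOpen U) {Φ Ψ : JetSymbol n}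
    (hΦ : SmoothSymbol U Φ) (hΨ : SmoothSymbol U Ψ) {a b c u : ℝ → Fin n → ℝ}
    (ha : SmoothPeriodic a) (hb : SmoothPeriodic b) (hc : SmoothPeriodic c) (hu : IsLoop U u) :
    Continuous (fun x => ∑ i, a x i * fderiv ℝ (fun j => Φ j (jet 2 b x)) (jet 2 u x)
      (jet 2 (fun y => Ψ (jet 2 u y) (jet 2 c y)) x) i) := by
  refine continuous_finsetSum _ fun i _ => (ha.coord i).continuous.mul ?_
  simp only [hΦ.fderiv_eq hU (hu.jet_mem 2 _)]
  have h₁ : ContDiffOn ℝ ∞ (fderiv ℝ (fun p : Jet₂ n × Jet₂ n => Φ p.1 p.2))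
      {p | p.1 0 ∈ U} := hΦ.fderiv_of_isOpen (isOpen_symbolDomain hU) (by simp)
  have h₂ : ContDiff ℝ ∞
      (fun x => fderiv ℝ (fun p : Jet₂ n × Jet₂ n => Φ p.1 p.2) (jet 2 u x, jet 2 b x)) :=
    h₁.comp_contDiff ((hu.smoothPeriodic.jet 2).smooth.prodMk (hb.jet 2).smooth) (hu.jet_mem 2)
  have h₃ := ((hΨ.smoothPeriodic hu hc).jet 2).smooth
  exact (continuous_apply i).comp (h₂.clm_apply (h₃.prodMk contDiff_const)).continuous

theorem variationPairing_add_left (hU : IsOpen U) {Φ Φ' Ψ : JetSymbol n}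
    (hΦ : SmoothSymbol U Φ) (hΦ' : SmoothSymbol U Φ') (hΨ : SmoothSymbol U Ψ)
    {a b c u : ℝ → Fin n → ℝ} (ha : SmoothPeriodic a) (hb : SmoothPeriodic b)
    (hc : SmoothPeriodic c) (hu : IsLoop U u) : variationPairing (Φ + Φ') Ψ a b c u =
      variationPairing Φ Ψ a b c u + variationPairing Φ' Ψ a b c u := by
  rw [variationPairing, variationPairing, variationPairing, ← intervalIntegral.integral_add
    ((continuous_variationPairing_integrand hU hΦ hΨ ha hb hc hu).intervalIntegrable _ _)
    ((continuous_variationPairing_integrand hU hΦ' hΨ ha hb hc hu).intervalIntegrable _ _)]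
  refine intervalIntegral.integral_congr fun x _ => ?_
  have h : fderiv ℝ (fun j => (Φ + Φ') j (jet 2 b x)) (jet 2 u x) =
      fderiv ℝ (fun j => Φ j (jet 2 b x)) (jet 2 u x)
        + fderiv ℝ (fun j => Φ' j (jet 2 b x)) (jet 2 u x) :=
    fderiv_fun_add (hΦ.differentiableAt hU (hu.jet_mem 2 x) _) (hΦ'.differentiableAt hU (hu.jet_mem 2 x) _)
  simp only [h, ← Finset.sum_add_distrib]
  refine Finset.sum_congr rfl fun i _ => ?_
  simp [mul_add]

theorem jet_add {m : ℕ} {u v : ℝ → Fin n → ℝ} (hu : SmoothPeriodic u) (hv : SmoothPeriodic v)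
    (x : ℝ) : jet m (fun y => u y + v y) x = jet m u x + jet m v x := by
  ext1 s
  exact iteratedDeriv_fun_add (hu.smooth.contDiffAt.of_le (by exact_mod_cast le_top))
    (hv.smooth.contDiffAt.of_le (by exact_mod_cast le_top))

theorem variationPairing_add_right (hU : IsOpen U) {Φ Ψ Ψ' : JetSymbol n}
    (hΦ : SmoothSymbol U Φ) (hΨ : SmoothSymbol U Ψ) (hΨ' : SmoothSymbol U Ψ')
    {a b c u : ℝ → Fin n → ℝ} (ha : SmoothPeriodic a) (hb : SmoothPeriodic b)
    (hc : SmoothPeriodic c) (hu : IsLoop U u) : variationPairing Φ (Ψ + Ψ') a b c u =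
      variationPairing Φ Ψ a b c u + variationPairing Φ Ψ' a b c u := by
  rw [variationPairing, variationPairing, variationPairing, ← intervalIntegral.integral_add
    ((continuous_variationPairing_integrand hU hΦ hΨ ha hb hc hu).intervalIntegrable _ _)
    ((continuous_variationPairing_integrand hU hΦ hΨ' ha hb hc hu).intervalIntegrable _ _)]
  refine intervalIntegral.integral_congr fun x _ => ?_
  have h := jet_add (m := 2) (hΨ.smoothPeriodic hu hc) (hΨ'.smoothPeriodic hu hc) x
  simp only [← Finset.sum_add_distrib, Pi.add_apply] at h ⊢
  rw [h]
  refine Finset.sum_congr rfl fun i _ => ?_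
  simp [mul_add]

/-- The part of `variationPairing` for `Φ + Ψ` that is bilinear in `Φ` and `Ψ`. -/
noncomputable def mixedPairing (Φ Ψ : JetSymbol n) (a b c u : ℝ → Fin n → ℝ) : ℝ :=
  variationPairing Φ Ψ a b c u + variationPairing Ψ Φ a b c u

theorem variationPairing_add_add (hU : IsOpen U) {Φ Ψ : JetSymbol n}
    (hΦ : SmoothSymbol U Φ) (hΨ : SmoothSymbol U Ψ) {a b c u : ℝ → Fin n → ℝ}
    (ha : SmoothPeriodic a) (hb : SmoothPeriodic b) (hc : SmoothPeriodic c) (hu : IsLoop U u) :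
    variationPairing (Φ + Ψ) (Φ + Ψ) a b c u = variationPairing Φ Φ a b c u
      + variationPairing Ψ Ψ a b c u + mixedPairing Φ Ψ a b c u := by
  rw [variationPairing_add_left hU hΦ hΨ (hΦ.add hΨ) ha hb hc hu,
    variationPairing_add_right hU hΦ hΦ hΨ ha hb hc hu,
    variationPairing_add_right hU hΨ hΦ hΨ ha hb hc hu, mixedPairing]
  ring

/-- Polarisation: the pairing is quadratic in the operator, so the relations for `P`, `Q` and `P +
Q` leave the one for the cross terms. -/
theorem cyclic_mixedPairing (hU : IsOpen U) {Φ Ψ : JetSymbol n}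
    (hΦ : SmoothSymbol U Φ) (hΨ : SmoothSymbol U Ψ) (hP : IsHamiltonian U (jetOperator Φ))
    (hQ : IsHamiltonian U (jetOperator Ψ)) (hPQ : IsHamiltonian U (jetOperator (Φ + Ψ)))
    {a b c u : ℝ → Fin n → ℝ} (ha : SmoothPeriodic a) (hb : SmoothPeriodic b)
    (hc : SmoothPeriodic c) (hu : IsLoop U u) :
    mixedPairing Φ Ψ a b c u + mixedPairing Φ Ψ b c a u + mixedPairing Φ Ψ c a b u = 0 := by
  have h₁ := hP.cyclic_variationPairing hU hΦ ha hb hc hu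
  have h₂ := hQ.cyclic_variationPairing hU hΨ ha hb hc hu
  have h₃ := hPQ.cyclic_variationPairing hU (hΦ.add hΨ) ha hb hc hu
  rw [variationPairing_add_add hU hΦ hΨ ha hb hc hu, variationPairing_add_add hU hΦ hΨ hb hc ha hu,
    variationPairing_add_add hU hΦ hΨ hc ha hb hu] at h₃
  linarith

theorem mixedPairing_swap (hU : IsOpen U) {Φ Ψ : JetSymbol n}
    (hΦ : SmoothSymbol U Φ) (hΨ : SmoothSymbol U Ψ) (hP : IsHamiltonian U (jetOperator Φ))
    (hQ : IsHamiltonian U (jetOperator Ψ)) (hPQ : IsHamiltonian U (jetOperator (Φ + Ψ)))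
    {a b c u : ℝ → Fin n → ℝ} (ha : SmoothPeriodic a) (hb : SmoothPeriodic b)
    (hc : SmoothPeriodic c) (hu : IsLoop U u) :
    mixedPairing Φ Ψ a b c u + mixedPairing Φ Ψ b a c u = 0 := by
  have h₁ := hP.variationPairing_swap hU hΦ ha hb hc hu
  have h₂ := hQ.variationPairing_swap hU hΨ ha hb hc hu
  have h₃ := hPQ.variationPairing_swap hU (hΦ.add hΨ) ha hb hc hu
  rw [variationPairing_add_add hU hΦ hΨ ha hb hc hu,
    variationPairing_add_add hU hΦ hΨ hb ha hc hu] at h₃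
  linarith

end LoopSpace

namespace LoopSpace

/-! ### Symbols of operators of degree one and two -/

variable {n : ℕ} {U : Set (Fin n → ℝ)}

/-- The symbol of `firstOrderOperator g b`. -/
def firstOrderSymbol (g : Fin n → Fin n → (Fin n → ℝ) → ℝ)
    (b : Fin n → Fin n → Fin n → (Fin n → ℝ) → ℝ) : JetSymbol n :=
  fun j η i => ∑ l, (g i l (j 0) * η 1 l + ∑ k, b i l k (j 0) * j 1 k * η 0 l)

/-- The symbol of `secondOrderOperator a b c₂ c`. -/
def secondOrderSymbol (a : Fin n → Fin n → (Fin n → ℝ) → ℝ)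
    (b : Fin n → Fin n → Fin n → (Fin n → ℝ) → ℝ)
    (c₂ : Fin n → Fin n → Fin n → Fin n → (Fin n → ℝ) → ℝ)
    (c : Fin n → Fin n → Fin n → (Fin n → ℝ) → ℝ) : JetSymbol n :=
  fun j η i => ∑ m, (a i m (j 0) * η 2 m
    + ∑ k, b i m k (j 0) * j 1 k * η 1 m
    + ∑ k, ∑ l, c₂ i m k l (j 0) * j 1 k * j 1 l * η 0 m
    + ∑ k, c i m k (j 0) * j 2 k * η 0 m)

theorem jet_apply_one (u : ℝ → Fin n → ℝ) (x : ℝ) : jet 2 u x 1 = deriv u x := by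
  simp [jet]

theorem jet_apply_two (u : ℝ → Fin n → ℝ) (x : ℝ) : jet 2 u x 2 = iteratedDeriv 2 u x := rfl

theorem jetOperator_firstOrderSymbol (g : Fin n → Fin n → (Fin n → ℝ) → ℝ)
    (b : Fin n → Fin n → Fin n → (Fin n → ℝ) → ℝ) :
    jetOperator (firstOrderSymbol g b) = firstOrderOperator g b := by
  funext u ψ x i
  simp only [jetOperator, firstOrderSymbol, firstOrderOperator, jet_zero, jet_apply_one]

theorem jetOperator_secondOrderSymbol (a : Fin n → Fin n → (Fin n → ℝ) → ℝ)
    (b : Fin n → Fin n → Fin n → (Fin n → ℝ) → ℝ)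
    (c₂ : Fin n → Fin n → Fin n → Fin n → (Fin n → ℝ) → ℝ)
    (c : Fin n → Fin n → Fin n → (Fin n → ℝ) → ℝ) :
    jetOperator (secondOrderSymbol a b c₂ c) = secondOrderOperator a b c₂ c := by
  funext u ψ x i
  simp only [jetOperator, secondOrderSymbol, secondOrderOperator, jet_zero, jet_apply_one,
    jet_apply_two]

theorem contDiffOn_coefficient {F : (Fin n → ℝ) → ℝ} (hF : ContDiffOn ℝ ∞ F U) :
    ContDiffOn ℝ ∞ (fun p : Jet₂ n × Jet₂ n => F (p.1 0)) {p | p.1 0 ∈ U} :=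
  hF.comp (((contDiff_apply ℝ _ (0 : Fin (2 + 1))).comp contDiff_fst).contDiffOn) fun _ hp => hp

theorem smoothSymbol_firstOrderSymbol {g : Fin n → Fin n → (Fin n → ℝ) → ℝ}
    {b : Fin n → Fin n → Fin n → (Fin n → ℝ) → ℝ} (hg : ∀ i j, ContDiffOn ℝ ∞ (g i j) U)
    (hb : ∀ i j k, ContDiffOn ℝ ∞ (b i j k) U) : SmoothSymbol U (firstOrderSymbol g b) := by
  have h₁ : ∀ s m, ContDiff ℝ ∞ (fun p : Jet₂ n × Jet₂ n => p.1 s m) := fun s m => by fun_prop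
  have h₂ : ∀ s m, ContDiff ℝ ∞ (fun p : Jet₂ n × Jet₂ n => p.2 s m) := fun s m => by fun_prop
  refine contDiffOn_pi.2 fun i => ContDiffOn.sum fun l _ => ContDiffOn.add ?_ ?_
  · exact (contDiffOn_coefficient (hg i l)).mul (h₂ 1 l).contDiffOn
  · exact ContDiffOn.sum fun k _ =>
      ((contDiffOn_coefficient (hb i l k)).mul (h₁ 1 k).contDiffOn).mul (h₂ 0 l).contDiffOn

theorem smoothSymbol_secondOrderSymbol {a : Fin n → Fin n → (Fin n → ℝ) → ℝ}
    {b c : Fin n → Fin n → Fin n → (Fin n → ℝ) → ℝ}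
    {c₂ : Fin n → Fin n → Fin n → Fin n → (Fin n → ℝ) → ℝ}
    (ha : ∀ i j, ContDiffOn ℝ ∞ (a i j) U) (hb : ∀ i j k, ContDiffOn ℝ ∞ (b i j k) U)
    (hc₂ : ∀ i j k l, ContDiffOn ℝ ∞ (c₂ i j k l) U) (hc : ∀ i j k, ContDiffOn ℝ ∞ (c i j k) U) :
    SmoothSymbol U (secondOrderSymbol a b c₂ c) := by
  have h₁ : ∀ s m, ContDiff ℝ ∞ (fun p : Jet₂ n × Jet₂ n => p.1 s m) := fun s m => by fun_prop
  have h₂ : ∀ s m, ContDiff ℝ ∞ (fun p : Jet₂ n × Jet₂ n => p.2 s m) := fun s m => by fun_prop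
  refine contDiffOn_pi.2 fun i => ContDiffOn.sum fun l _ =>
    ((ContDiffOn.add ?_ ?_).add ?_).add ?_
  · exact (contDiffOn_coefficient (ha i l)).mul (h₂ 2 l).contDiffOn
  · exact ContDiffOn.sum fun k _ =>
      ((contDiffOn_coefficient (hb i l k)).mul (h₁ 1 k).contDiffOn).mul (h₂ 1 l).contDiffOn
  · exact ContDiffOn.sum fun k _ => ContDiffOn.sum fun m _ =>
      (((contDiffOn_coefficient (hc₂ i l k m)).mul (h₁ 1 k).contDiffOn).mul
        (h₁ 1 m).contDiffOn).mul (h₂ 0 l).contDiffOn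
  · exact ContDiffOn.sum fun k _ =>
      ((contDiffOn_coefficient (hc i l k)).mul (h₁ 2 k).contDiffOn).mul (h₂ 0 l).contDiffOn

theorem hasDerivAt_coefficient (hU : IsOpen U) {F : (Fin n → ℝ) → ℝ} (hF : ContDiffOn ℝ ∞ F U)
    {j : Jet₂ n} (hj : j 0 ∈ U) (ξ : Jet₂ n) :
    HasDerivAt (fun t : ℝ => F ((j + t • ξ) 0)) (fderiv ℝ F (j 0) (ξ 0)) 0 := by
  have h₁ : HasFDerivAt F (fderiv ℝ F (j 0)) ((j + (0 : ℝ) • ξ) 0) := by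
    have h := (hF.contDiffAt (hU.mem_nhds hj)).differentiableAt (by simp)
    simpa using h.hasFDerivAt
  have h₂ : HasDerivAt (fun t : ℝ => (j + t • ξ) 0) (ξ 0) 0 := by
    simpa using ((hasDerivAt_id (0 : ℝ)).smul_const (ξ 0)).const_add (j 0)
  exact h₁.comp_hasDerivAt (0 : ℝ) h₂

theorem hasDerivAt_jetCoordinate (j ξ : Jet₂ n) (s : Fin (2 + 1)) (m : Fin n) :
    HasDerivAt (fun t : ℝ => (j + t • ξ) s m) (ξ s m) 0 := by
  simpa using ((hasDerivAt_id (0 : ℝ)).mul_const (ξ s m)).const_add (j s m)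

/-- Reduces a derivative of the symbol to a one-variable derivative along `j + t ξ`, where product
and chain rules apply term by term. -/
theorem SmoothSymbol.fderiv_apply_eq (hU : IsOpen U) {Φ : JetSymbol n} (hΦ : SmoothSymbol U Φ)
    {j : Jet₂ n} (hj : j 0 ∈ U) (η ξ : Jet₂ n) (i : Fin n) {d : ℝ}
    (hd : HasDerivAt (fun t : ℝ => Φ (j + t • ξ) η i) d 0) :
    fderiv ℝ (fun j => Φ j η) j ξ i = d := by
  have h₁ : HasFDerivAt (fun j => Φ j η) (fderiv ℝ (fun j => Φ j η) j) (j + (0 : ℝ) • ξ) := by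
    simpa using (hΦ.differentiableAt hU hj η).hasFDerivAt
  have h₂ : HasDerivAt (fun t : ℝ => j + t • ξ) ξ 0 := by
    simpa using ((hasDerivAt_id (0 : ℝ)).smul_const ξ).const_add j
  exact ((hasDerivAt_pi.1 (h₁.comp_hasDerivAt (0 : ℝ) h₂)) i).unique hd

theorem fderiv_firstOrderSymbol (hU : IsOpen U) {g : Fin n → Fin n → (Fin n → ℝ) → ℝ}
    {b : Fin n → Fin n → Fin n → (Fin n → ℝ) → ℝ} (hg : ∀ i j, ContDiffOn ℝ ∞ (g i j) U)
    (hb : ∀ i j k, ContDiffOn ℝ ∞ (b i j k) U) {j : Jet₂ n} (hj : j 0 ∈ U) (η ξ : Jet₂ n)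
    (i : Fin n) : fderiv ℝ (fun j => firstOrderSymbol g b j η) j ξ i =
      ∑ l, (fderiv ℝ (g i l) (j 0) (ξ 0) * η 1 l + ∑ k, (fderiv ℝ (b i l k) (j 0) (ξ 0) * j 1 k
        + b i l k (j 0) * ξ 1 k) * η 0 l) := by
  refine (smoothSymbol_firstOrderSymbol hg hb).fderiv_apply_eq hU hj η ξ i ?_
  refine HasDerivAt.fun_sum fun l _ => ((hasDerivAt_coefficient hU (hg i l) hj ξ).mul_const _).add
    (HasDerivAt.fun_sum fun k _ => HasDerivAt.mul_const ?_ _)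
  simpa using (hasDerivAt_coefficient hU (hb i l k) hj ξ).fun_mul (hasDerivAt_jetCoordinate j ξ 1 k)

theorem fderiv_secondOrderSymbol (hU : IsOpen U) {a : Fin n → Fin n → (Fin n → ℝ) → ℝ}
    {b c : Fin n → Fin n → Fin n → (Fin n → ℝ) → ℝ}
    {c₂ : Fin n → Fin n → Fin n → Fin n → (Fin n → ℝ) → ℝ}
    (ha : ∀ i j, ContDiffOn ℝ ∞ (a i j) U) (hb : ∀ i j k, ContDiffOn ℝ ∞ (b i j k) U)
    (hc₂ : ∀ i j k l, ContDiffOn ℝ ∞ (c₂ i j k l) U) (hc : ∀ i j k, ContDiffOn ℝ ∞ (c i j k) U)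
    {j : Jet₂ n} (hj : j 0 ∈ U) (η ξ : Jet₂ n) (i : Fin n) :
    fderiv ℝ (fun j => secondOrderSymbol a b c₂ c j η) j ξ i =
      ∑ m, (fderiv ℝ (a i m) (j 0) (ξ 0) * η 2 m
        + ∑ k, (fderiv ℝ (b i m k) (j 0) (ξ 0) * j 1 k + b i m k (j 0) * ξ 1 k) * η 1 m
        + ∑ k, ∑ l, ((fderiv ℝ (c₂ i m k l) (j 0) (ξ 0) * j 1 k + c₂ i m k l (j 0) * ξ 1 k) * j 1 l
          + c₂ i m k l (j 0) * j 1 k * ξ 1 l) * η 0 m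
        + ∑ k, (fderiv ℝ (c i m k) (j 0) (ξ 0) * j 2 k + c i m k (j 0) * ξ 2 k) * η 0 m) := by
  refine (smoothSymbol_secondOrderSymbol ha hb hc₂ hc).fderiv_apply_eq hU hj η ξ i ?_
  refine HasDerivAt.fun_sum fun m _ => ((((hasDerivAt_coefficient hU (ha i m) hj ξ).mul_const _).add
    (HasDerivAt.fun_sum fun k _ => HasDerivAt.mul_const ?_ _)).add
    (HasDerivAt.fun_sum fun k _ => HasDerivAt.fun_sum fun l _ => HasDerivAt.mul_const ?_ _)).add
    (HasDerivAt.fun_sum fun k _ => HasDerivAt.mul_const ?_ _)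
  · simpa using (hasDerivAt_coefficient hU (hb i m k) hj ξ).fun_mul (hasDerivAt_jetCoordinate j ξ 1 k)
  · simpa using ((hasDerivAt_coefficient hU (hc₂ i m k l) hj ξ).fun_mul
      (hasDerivAt_jetCoordinate j ξ 1 k)).fun_mul (hasDerivAt_jetCoordinate j ξ 1 l)
  · simpa using (hasDerivAt_coefficient hU (hc i m k) hj ξ).fun_mul (hasDerivAt_jetCoordinate j ξ 2 k)

/-! ### Evaluation at constant loops -/

theorem isLoop_const {y : Fin n → ℝ} (hy : y ∈ U) : IsLoop U (fun _ => y) :=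
  ⟨contDiff_const, fun _ => rfl, fun _ => hy⟩

theorem jet_const_one (y : Fin n → ℝ) (x : ℝ) : jet 2 (fun _ => y) x 1 = 0 := by
  simp [jet_apply_one]

theorem jet_const_two (y : Fin n → ℝ) (x : ℝ) : jet 2 (fun _ => y) x 2 = 0 := by
  simp [jet_apply_two, iteratedDeriv_const]

/-- With `u_x = u_{xx} = 0` only the leading term of the second order operator survives, so the
direction of variation does not see the lower coefficients. -/
theorem variationPairing_const_congr (Φ : JetSymbol n) (a : Fin n → Fin n → (Fin n → ℝ) → ℝ)
    (b c b' c' : Fin n → Fin n → Fin n → (Fin n → ℝ) → ℝ)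
    (c₂ c₂' : Fin n → Fin n → Fin n → Fin n → (Fin n → ℝ) → ℝ) (p q r : ℝ → Fin n → ℝ)
    (y : Fin n → ℝ) :
    variationPairing Φ (secondOrderSymbol a b c₂ c) p q r (fun _ => y) =
      variationPairing Φ (secondOrderSymbol a b' c₂' c') p q r (fun _ => y) := by
  have h : (fun x => secondOrderSymbol a b c₂ c (jet 2 (fun _ => y) x) (jet 2 r x)) =
      fun x => secondOrderSymbol a b' c₂' c' (jet 2 (fun _ => y) x) (jet 2 r x) := by
    funext x i
    simp [secondOrderSymbol, jet_const_one, jet_const_two]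
  rw [variationPairing, variationPairing, h]

/-- Such a first order operator does not change under small variations of the loop. This is the gain
from flat coordinates. -/
theorem variationPairing_eq_zero_of_const {Φ : JetSymbol n} (hU : IsOpen U)
    {g : Fin n → Fin n → (Fin n → ℝ) → ℝ} {b : Fin n → Fin n → Fin n → (Fin n → ℝ) → ℝ}
    (hg : ∀ i j, ContDiffOn ℝ ∞ (g i j) U) (hb : ∀ i j k, ContDiffOn ℝ ∞ (b i j k) U)
    (hg₀ : ∀ i j, ∀ y ∈ U, fderiv ℝ (g i j) y = 0) (hb₀ : ∀ i j k, ∀ y ∈ U, b i j k y = 0)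
    (p q r : ℝ → Fin n → ℝ) {u : ℝ → Fin n → ℝ} (hu : IsLoop U u) :
    variationPairing (firstOrderSymbol g b) Φ p q r u = 0 := by
  have hb₁ : ∀ i j k, ∀ y ∈ U, fderiv ℝ (b i j k) y = 0 := fun i j k y hy => by
    have h : b i j k =ᶠ[nhds y] fun _ => 0 :=
      Filter.eventually_of_mem (hU.mem_nhds hy) (hb₀ i j k)
    rw [h.fderiv_eq]
    simp
  simp [variationPairing, fderiv_firstOrderSymbol hU hg hb (hu.jet_mem 2 _),
    hg₀ _ _ _ (hu.jet_mem 2 _), hb₀ _ _ _ _ (hu.jet_mem 2 _), hb₁ _ _ _ _ (hu.jet_mem 2 _)]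

theorem iteratedDeriv_smul_const {q : ℝ → ℝ} (hq : SmoothPeriodic q) (v : Fin n → ℝ) (s : ℕ) :
    iteratedDeriv s (fun x => q x • v) = fun x => iteratedDeriv s q x • v := by
  induction s with
  | zero => simp
  | succ s ih =>
    funext x
    rw [iteratedDeriv_succ, ih, iteratedDeriv_succ]
    exact deriv_smul_const ((hq.iteratedDeriv s).differentiable x) v

theorem jet_smul_const {q : ℝ → ℝ} (hq : SmoothPeriodic q) (v : Fin n → ℝ) (m : ℕ) (x : ℝ)
    (s : Fin (m + 1)) : jet m (fun x => q x • v) x s = iteratedDeriv (s : ℕ) q x • v :=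
  congrFun (iteratedDeriv_smul_const hq v s) x

/-- The direction of variation is `r' g^{·k}`. The terms with `c₂` are quadratic in `u_x`, so their
first variation at a constant loop is zero; what remains has three derivatives distributed over `q`
and `r`. -/
theorem variationPairing_const (hU : IsOpen U) {a g : Fin n → Fin n → (Fin n → ℝ) → ℝ}
    {b c β : Fin n → Fin n → Fin n → (Fin n → ℝ) → ℝ}
    {c₂ : Fin n → Fin n → Fin n → Fin n → (Fin n → ℝ) → ℝ}
    (ha : ∀ i j, ContDiffOn ℝ ∞ (a i j) U) (hb : ∀ i j k, ContDiffOn ℝ ∞ (b i j k) U)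
    (hc₂ : ∀ i j k l, ContDiffOn ℝ ∞ (c₂ i j k l) U) (hc : ∀ i j k, ContDiffOn ℝ ∞ (c i j k) U)
    {y : Fin n → ℝ} (hy : y ∈ U) {p q r : ℝ → ℝ} (hq : SmoothPeriodic q)
    (hr : SmoothPeriodic r) (i j k : Fin n) :
    variationPairing (secondOrderSymbol a b c₂ c) (firstOrderSymbol g β)
      (fun x => p x • Pi.single i 1) (fun x => q x • Pi.single j 1) (fun x => r x • Pi.single k 1)
      (fun _ => y) =
    ∫ x in (0 : ℝ)..1, p x * (fderiv ℝ (a i j) y (fun m => g m k y) * iteratedDeriv 2 q x * deriv r x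
      + (∑ m, b i j m y * g m k y) * deriv q x * iteratedDeriv 2 r x
      + (∑ m, c i j m y * g m k y) * q x * iteratedDeriv 3 r x) := by
  have h₁ : (fun x => firstOrderSymbol g β (jet 2 (fun _ => y) x)
      (jet 2 (fun x => r x • Pi.single k 1) x)) = fun x => deriv r x • fun m => g m k y := by
    funext x m
    simp [firstOrderSymbol, jet_const_one, jet_zero, jet_smul_const hr, Pi.single_apply, mul_comm]
  rw [variationPairing, h₁]
  refine intervalIntegral.integral_congr fun x _ => ?_
  have h₂ : ∀ s : Fin (2 + 1), jet 2 (fun x => deriv r x • fun m => g m k y) x s =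
      iteratedDeriv (s + 1 : ℕ) r x • fun m => g m k y := fun s => by
    rw [jet_smul_const hr.deriv, iteratedDeriv_succ']
  simp only [fderiv_secondOrderSymbol hU ha hb hc₂ hc ((isLoop_const hy).jet_mem 2 _), h₂,
    jet_const_one, jet_const_two, jet_zero, jet_smul_const hq]
  simp only [Pi.smul_apply, smul_eq_mul, Pi.single_apply, map_smul, Pi.zero_apply, mul_zero,
    zero_add, add_zero, zero_mul, Finset.sum_const_zero, mul_ite, mul_one, ite_mul,
    Finset.sum_ite_eq', Finset.sum_add_distrib, Finset.mem_univ, if_true, Finset.sum_ite_irrel]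
  simp only [Finset.mul_sum, Finset.sum_mul, iteratedDeriv_one, Fin.val_zero, Fin.val_one,
    Fin.val_two, iteratedDeriv_zero, zero_add, one_add_one_eq_two, Nat.reduceAdd, mul_add]
  refine congrArg₂ _ (congrArg₂ _ ?_ ?_) ?_
  · ring
  · refine Finset.sum_congr rfl fun m _ => ?_
    ring
  · refine Finset.sum_congr rfl fun m _ => ?_
    ring

end LoopSpace

namespace LoopSpace

/-! ### Trigonometric test functions -/

/-- The function `sin (2π m x)`. -/
noncomputable def sinLoop (m : ℕ) (x : ℝ) : ℝ := Real.sin (2 * Real.pi * m * x)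

/-- The function `cos (2π m x)`. -/
noncomputable def cosLoop (m : ℕ) (x : ℝ) : ℝ := Real.cos (2 * Real.pi * m * x)

open Real in
theorem smoothPeriodic_sinLoop (m : ℕ) : SmoothPeriodic (sinLoop m) where
  smooth := by unfold sinLoop; fun_prop
  periodic x := by
    have h := sin_add_nat_mul_two_pi (2 * π * m * x) m
    rw [sinLoop, sinLoop, ← h]
    ring_nf

open Real in
theorem smoothPeriodic_cosLoop (m : ℕ) : SmoothPeriodic (cosLoop m) where
  smooth := by unfold cosLoop; fun_prop
  periodic x := by
    have h := cos_add_nat_mul_two_pi (2 * π * m * x) m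
    rw [cosLoop, cosLoop, ← h]
    ring_nf

theorem deriv_sin_mul (w : ℝ) :
    deriv (fun x => Real.sin (w * x)) = fun x => w * Real.cos (w * x) := by
  funext x
  have h := ((hasDerivAt_id x).const_mul w).sin.deriv
  simpa [mul_comm] using h

theorem deriv_cos_mul (w : ℝ) :
    deriv (fun x => Real.cos (w * x)) = fun x => -w * Real.sin (w * x) := by
  funext x
  have h := ((hasDerivAt_id x).const_mul w).cos.deriv
  simpa [mul_comm] using h

theorem iteratedDeriv_two_sin_mul (w : ℝ) :
    iteratedDeriv 2 (fun x => Real.sin (w * x)) = fun x => -w ^ 2 * Real.sin (w * x) := by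
  funext x
  rw [iteratedDeriv_succ, iteratedDeriv_one, deriv_sin_mul, deriv_const_mul_field, deriv_cos_mul]
  ring

theorem iteratedDeriv_two_cos_mul (w : ℝ) :
    iteratedDeriv 2 (fun x => Real.cos (w * x)) = fun x => -w ^ 2 * Real.cos (w * x) := by
  funext x
  rw [iteratedDeriv_succ, iteratedDeriv_one, deriv_cos_mul, deriv_const_mul_field, deriv_sin_mul]
  ring

theorem iteratedDeriv_three_sin_mul (w : ℝ) :
    iteratedDeriv 3 (fun x => Real.sin (w * x)) = fun x => -w ^ 3 * Real.cos (w * x) := by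
  funext x
  rw [iteratedDeriv_succ, iteratedDeriv_two_sin_mul, deriv_const_mul_field, deriv_sin_mul]
  ring

theorem iteratedDeriv_three_cos_mul (w : ℝ) :
    iteratedDeriv 3 (fun x => Real.cos (w * x)) = fun x => w ^ 3 * Real.sin (w * x) := by
  funext x
  rw [iteratedDeriv_succ, iteratedDeriv_two_cos_mul, deriv_const_mul_field, deriv_cos_mul]
  ring

open Real in
theorem integral_cos_period {m : ℕ} (hm : m ≠ 0) :
    ∫ x in (0 : ℝ)..1, cosLoop m x = 0 := by
  simp only [cosLoop]
  have hw : 2 * π * (m : ℝ) ≠ 0 := by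
    have : (m : ℝ) ≠ 0 := by exact_mod_cast hm
    positivity
  rw [intervalIntegral.integral_comp_mul_left (fun x => cos x) hw, integral_cos]
  have h := sin_nat_mul_pi (2 * m)
  push_cast at h
  simp [show 2 * π * (m : ℝ) = 2 * m * π by ring, h]

open Real in
-- The products of test functions used below have Fourier expansions in frequencies 0, 2 and 4 only,
-- so integrating picks out the constant term.
theorem integral_of_eq_cos {f : ℝ → ℝ} {α β γ : ℝ}
    (h : ∀ x, f x = α + β * cosLoop 2 x + γ * cosLoop 4 x) :
    ∫ x in (0 : ℝ)..1, f x = α := by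
  have h₂ : Continuous fun x => β * cosLoop 2 x :=
    continuous_const.mul (smoothPeriodic_cosLoop 2).continuous
  have h₄ : Continuous fun x => γ * cosLoop 4 x :=
    continuous_const.mul (smoothPeriodic_cosLoop 4).continuous
  simp only [h]
  rw [intervalIntegral.integral_add (f := fun x => α + β * cosLoop 2 x)
      ((continuous_const.add h₂).intervalIntegrable _ _) (h₄.intervalIntegrable _ _),
    intervalIntegral.integral_add (continuous_const.intervalIntegrable _ _)
      (h₂.intervalIntegrable _ _), intervalIntegral.integral_const_mul,
    intervalIntegral.integral_const_mul, integral_cos_period (by norm_num),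
    integral_cos_period (by norm_num)]
  simp

/-- The integral of a trilinear differential expression of order three in three functions. -/
noncomputable def trilinearIntegral (A B C : ℝ) (p q r : ℝ → ℝ) : ℝ :=
  ∫ x in (0 : ℝ)..1, p x * (A * iteratedDeriv 2 q x * deriv r x
    + B * deriv q x * iteratedDeriv 2 r x + C * q x * iteratedDeriv 3 r x)

section

open Real

variable (x : ℝ)

theorem cosLoop_one_sq : cosLoop 1 x ^ 2 = (1 + cosLoop 2 x) / 2 := by
  rw [cosLoop, cosLoop, cos_sq]
  push_cast
  ring_nf

theorem sinLoop_one_sq : sinLoop 1 x ^ 2 = (1 - cosLoop 2 x) / 2 := by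
  rw [sinLoop, sin_sq, ← cosLoop, cosLoop_one_sq]
  ring

theorem sinLoop_mul_cosLoop : sinLoop 1 x * cosLoop 1 x = sinLoop 2 x / 2 := by
  have h := sin_two_mul (2 * π * (1 : ℕ) * x)
  rw [show 2 * (2 * π * ((1 : ℕ) : ℝ) * x) = 2 * π * (2 : ℕ) * x by push_cast; ring] at h
  rw [sinLoop, sinLoop, cosLoop, h]
  ring

theorem cosLoop_two_sq : cosLoop 2 x ^ 2 = (1 + cosLoop 4 x) / 2 := by
  rw [cosLoop, cosLoop, cos_sq]
  push_cast
  ring_nf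

theorem sinLoop_two_sq : sinLoop 2 x ^ 2 = (1 - cosLoop 4 x) / 2 := by
  rw [sinLoop, sin_sq, ← cosLoop, cosLoop_two_sq]
  ring

variable (m : ℕ)

theorem deriv_sinLoop : deriv (sinLoop m) x = 2 * π * m * cosLoop m x :=
  congrFun (deriv_sin_mul _) x

theorem deriv_cosLoop : deriv (cosLoop m) x = -(2 * π * m) * sinLoop m x :=
  congrFun (deriv_cos_mul _) x

theorem iteratedDeriv_two_sinLoop :
    iteratedDeriv 2 (sinLoop m) x = -(2 * π * m) ^ 2 * sinLoop m x :=
  congrFun (iteratedDeriv_two_sin_mul _) x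

theorem iteratedDeriv_two_cosLoop :
    iteratedDeriv 2 (cosLoop m) x = -(2 * π * m) ^ 2 * cosLoop m x :=
  congrFun (iteratedDeriv_two_cos_mul _) x

theorem iteratedDeriv_three_sinLoop :
    iteratedDeriv 3 (sinLoop m) x = -(2 * π * m) ^ 3 * cosLoop m x :=
  congrFun (iteratedDeriv_three_sin_mul _) x

theorem iteratedDeriv_three_cosLoop :
    iteratedDeriv 3 (cosLoop m) x = (2 * π * m) ^ 3 * sinLoop m x :=
  congrFun (iteratedDeriv_three_cos_mul _) x

end

variable (A B C : ℝ)

open Real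

theorem trilinearIntegral_one_sin_cos :
    trilinearIntegral A B C (fun _ => 1) (sinLoop 1) (cosLoop 1) =
      (2 * π) ^ 3 / 2 * (A - B + C) := by
  refine integral_of_eq_cos (β := (2 * π) ^ 3 * (-A / 2 - B / 2 - C / 2)) (γ := 0) fun x => ?_
  rw [iteratedDeriv_two_sinLoop, deriv_cosLoop, deriv_sinLoop, iteratedDeriv_two_cosLoop,
    iteratedDeriv_three_cosLoop]
  push_cast
  linear_combination (2 * π) ^ 3 * (A + C) * sinLoop_one_sq x - (2 * π) ^ 3 * B * cosLoop_one_sq x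

theorem trilinearIntegral_sin_cos_one :
    trilinearIntegral A B C (sinLoop 1) (cosLoop 1) (fun _ => 1) = 0 := by
  simp [trilinearIntegral, iteratedDeriv_const]

theorem trilinearIntegral_cos_one_sin :
    trilinearIntegral A B C (cosLoop 1) (fun _ => 1) (sinLoop 1) = -((2 * π) ^ 3 / 2 * C) := by
  refine integral_of_eq_cos (β := -((2 * π) ^ 3 * C / 2)) (γ := 0) fun x => ?_
  rw [iteratedDeriv_three_sinLoop]
  simp only [iteratedDeriv_const, deriv_const]
  push_cast
  linear_combination -(2 * π) ^ 3 * C * cosLoop_one_sq x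

theorem trilinearIntegral_sin_one_cos :
    trilinearIntegral A B C (sinLoop 1) (fun _ => 1) (cosLoop 1) = (2 * π) ^ 3 / 2 * C := by
  refine integral_of_eq_cos (β := -((2 * π) ^ 3 * C / 2)) (γ := 0) fun x => ?_
  rw [iteratedDeriv_three_cosLoop]
  simp only [iteratedDeriv_const, deriv_const]
  push_cast
  linear_combination (2 * π) ^ 3 * C * sinLoop_one_sq x

theorem trilinearIntegral_cos_cos_sin :
    trilinearIntegral A B C (cosLoop 1) (cosLoop 1) (sinLoop 2) =
      (2 * π) ^ 3 / 2 * (-A + 2 * B - 4 * C) := by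
  refine integral_of_eq_cos (β := (2 * π) ^ 3 * (-A - 4 * C))
    (γ := (2 * π) ^ 3 / 2 * (-A - 2 * B - 4 * C)) fun x => ?_
  rw [iteratedDeriv_two_cosLoop, deriv_cosLoop, deriv_sinLoop, iteratedDeriv_two_sinLoop,
    iteratedDeriv_three_sinLoop]
  push_cast
  have h := cosLoop_one_sq x
  linear_combination (2 * π) ^ 3 * (-2 * A - 8 * C) * cosLoop 2 x * h
    + (2 * π) ^ 3 * 4 * B * sinLoop 2 x * sinLoop_mul_cosLoop x
    + (2 * π) ^ 3 * 2 * B * sinLoop_two_sq x + (2 * π) ^ 3 * (-A - 4 * C) * cosLoop_two_sq x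

theorem trilinearIntegral_cos_sin_cos :
    trilinearIntegral A B C (cosLoop 1) (sinLoop 2) (cosLoop 1) =
      (2 * π) ^ 3 / 2 * (2 * A - B + C / 2) := by
  refine integral_of_eq_cos (β := -((2 * π) ^ 3 * B))
    (γ := (2 * π) ^ 3 / 2 * (-2 * A - B - C / 2)) fun x => ?_
  rw [iteratedDeriv_two_cosLoop, deriv_cosLoop, deriv_sinLoop, iteratedDeriv_two_sinLoop,
    iteratedDeriv_three_cosLoop]
  push_cast
  have h := cosLoop_one_sq x
  linear_combination -(2 * π) ^ 3 * 2 * B * cosLoop 2 x * h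
    + (2 * π) ^ 3 * (4 * A + C) * sinLoop 2 x * sinLoop_mul_cosLoop x
    + (2 * π) ^ 3 * (2 * A + C / 2) * sinLoop_two_sq x - (2 * π) ^ 3 * B * cosLoop_two_sq x

theorem trilinearIntegral_sin_cos_cos :
    trilinearIntegral A B C (sinLoop 2) (cosLoop 1) (cosLoop 1) =
      (2 * π) ^ 3 / 2 * ((A + B + C) / 2) := by
  refine integral_of_eq_cos (β := 0)
    (γ := -((2 * π) ^ 3 / 2 * ((A + B + C) / 2))) fun x => ?_
  rw [iteratedDeriv_two_cosLoop, deriv_cosLoop, iteratedDeriv_three_cosLoop]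
  push_cast
  linear_combination (2 * π) ^ 3 * (A + B + C) * sinLoop 2 x * sinLoop_mul_cosLoop x
    + (2 * π) ^ 3 * ((A + B + C) / 2) * sinLoop_two_sq x

end LoopSpace

namespace LoopSpace

/-! ### Pencils of Hamiltonian operators of degrees one and two -/

variable {n : ℕ} {U : Set (Fin n → ℝ)}

/-- The operators `g^{ij} d/dx + b^{ij}_k u^k_x` and
`a^{ij} (d/dx)² + 2 c^{ij}_k u^k_x d/dx + c^{ij}_{kl} u^k_x u^l_x + c^{ij}_k u^k_{xx}` and their sum
are Hamiltonian. -/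
structure IsHamiltonianPencil (U : Set (Fin n → ℝ)) (g : Fin n → Fin n → (Fin n → ℝ) → ℝ)
    (b : Fin n → Fin n → Fin n → (Fin n → ℝ) → ℝ) (a : Fin n → Fin n → (Fin n → ℝ) → ℝ)
    (c₂ : Fin n → Fin n → Fin n → Fin n → (Fin n → ℝ) → ℝ)
    (c : Fin n → Fin n → Fin n → (Fin n → ℝ) → ℝ) : Prop where
  isOpen : IsOpen U
  smooth_g : ∀ i j, ContDiffOn ℝ ∞ (g i j) U
  smooth_b : ∀ i j k, ContDiffOn ℝ ∞ (b i j k) U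
  smooth_a : ∀ i j, ContDiffOn ℝ ∞ (a i j) U
  smooth_c₂ : ∀ i j k l, ContDiffOn ℝ ∞ (c₂ i j k l) U
  smooth_c : ∀ i j k, ContDiffOn ℝ ∞ (c i j k) U
  first : IsHamiltonian U (firstOrderOperator g b)
  second : IsHamiltonian U (secondOrderOperator a (fun i j k y => 2 * c i j k y) c₂ c)
  sum : IsHamiltonian U (firstOrderOperator g b
    + secondOrderOperator a (fun i j k y => 2 * c i j k y) c₂ c)

namespace IsHamiltonianPencil

variable {g a : Fin n → Fin n → (Fin n → ℝ) → ℝ} {b c c' : Fin n → Fin n → Fin n → (Fin n → ℝ) → ℝ}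
  {c₂ c₂' : Fin n → Fin n → Fin n → Fin n → (Fin n → ℝ) → ℝ}

theorem smooth_two_mul (h : IsHamiltonianPencil U g b a c₂ c) (i j k : Fin n) :
    ContDiffOn ℝ ∞ (fun y => 2 * c i j k y) U :=
  contDiffOn_const.mul (h.smooth_c i j k)

theorem smoothSymbol_first (h : IsHamiltonianPencil U g b a c₂ c) :
    SmoothSymbol U (firstOrderSymbol g b) :=
  smoothSymbol_firstOrderSymbol h.smooth_g h.smooth_b

theorem smoothSymbol_second (h : IsHamiltonianPencil U g b a c₂ c) :
    SmoothSymbol U (secondOrderSymbol a (fun i j k y => 2 * c i j k y) c₂ c) :=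
  smoothSymbol_secondOrderSymbol h.smooth_a h.smooth_two_mul h.smooth_c₂ h.smooth_c

theorem first_jetOperator (h : IsHamiltonianPencil U g b a c₂ c) :
    IsHamiltonian U (jetOperator (firstOrderSymbol g b)) := by
  rw [jetOperator_firstOrderSymbol]
  exact h.first

theorem second_jetOperator (h : IsHamiltonianPencil U g b a c₂ c) :
    IsHamiltonian U (jetOperator (secondOrderSymbol a (fun i j k y => 2 * c i j k y) c₂ c)) := by
  rw [jetOperator_secondOrderSymbol]
  exact h.second

theorem sum_jetOperator (h : IsHamiltonianPencil U g b a c₂ c) :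
    IsHamiltonian U (jetOperator (firstOrderSymbol g b
      + secondOrderSymbol a (fun i j k y => 2 * c i j k y) c₂ c)) := by
  have h₂ : ∀ Φ Ψ : JetSymbol n, jetOperator (Φ + Ψ) = jetOperator Φ + jetOperator Ψ :=
    fun Φ Ψ => rfl
  rw [h₂, jetOperator_firstOrderSymbol, jetOperator_secondOrderSymbol]
  exact h.sum

theorem cyclic (h : IsHamiltonianPencil U g b a c₂ c) {p q r u : ℝ → Fin n → ℝ}
    (hp : SmoothPeriodic p) (hq : SmoothPeriodic q) (hr : SmoothPeriodic r) (hu : IsLoop U u) :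
    mixedPairing (firstOrderSymbol g b)
        (secondOrderSymbol a (fun i j k y => 2 * c i j k y) c₂ c) p q r u
      + mixedPairing (firstOrderSymbol g b)
        (secondOrderSymbol a (fun i j k y => 2 * c i j k y) c₂ c) q r p u
      + mixedPairing (firstOrderSymbol g b)
        (secondOrderSymbol a (fun i j k y => 2 * c i j k y) c₂ c) r p q u = 0 :=
  cyclic_mixedPairing h.isOpen h.smoothSymbol_first h.smoothSymbol_second h.first_jetOperator
    h.second_jetOperator h.sum_jetOperator hp hq hr hu

theorem swap (h : IsHamiltonianPencil U g b a c₂ c) {p q r u : ℝ → Fin n → ℝ}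
    (hp : SmoothPeriodic p) (hq : SmoothPeriodic q) (hr : SmoothPeriodic r) (hu : IsLoop U u) :
    mixedPairing (firstOrderSymbol g b)
        (secondOrderSymbol a (fun i j k y => 2 * c i j k y) c₂ c) p q r u
      + mixedPairing (firstOrderSymbol g b)
        (secondOrderSymbol a (fun i j k y => 2 * c i j k y) c₂ c) q p r u = 0 :=
  mixedPairing_swap h.isOpen h.smoothSymbol_first h.smoothSymbol_second h.first_jetOperator
    h.second_jetOperator h.sum_jetOperator hp hq hr hu

/-- The middle coefficient is twice the last because `u_x d/dx` carries `2 c` and `u_{xx}` carries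
`c`. -/
theorem variationPairing_second_first (h : IsHamiltonianPencil U g b a c₂ c) {y : Fin n → ℝ}
    (hy : y ∈ U) {p q r : ℝ → ℝ} (hq : SmoothPeriodic q) (hr : SmoothPeriodic r) (i j k : Fin n) :
    variationPairing (secondOrderSymbol a (fun i j k y => 2 * c i j k y) c₂ c)
      (firstOrderSymbol g b) (fun x => p x • Pi.single i 1) (fun x => q x • Pi.single j 1)
      (fun x => r x • Pi.single k 1) (fun _ => y) =
    trilinearIntegral (fderiv ℝ (a i j) y (fun m => g m k y)) (2 * ∑ m, c i j m y * g m k y)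
      (∑ m, c i j m y * g m k y) p q r := by
  rw [variationPairing_const h.isOpen h.smooth_a h.smooth_two_mul h.smooth_c₂ h.smooth_c hy hq hr,
    trilinearIntegral]
  simp only [mul_assoc, ← Finset.mul_sum]

theorem cancel_metric {y : Fin n → ℝ} (hg : IsUnit (Matrix.of fun i j => g i j y).det)
    {v : Fin n → ℝ} (hv : ∀ k, ∑ m, v m * g m k y = 0) : v = 0 := by
  have h : Matrix.vecMul v (Matrix.of fun i j => g i j y) = 0 := funext fun k => hv k
  have h₂ := congrArg (fun w => Matrix.vecMul w (Matrix.of fun i j => g i j y)⁻¹) h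
  simpa [Matrix.vecMul_vecMul, Matrix.mul_nonsing_inv _ hg] using h₂

/-- The coefficients `c^{ij}_k` of a pencil are determined by the leading coefficients and the first
order operator. -/
theorem coefficient_unique (h : IsHamiltonianPencil U g b a c₂ c)
    (h' : IsHamiltonianPencil U g b a c₂' c') {y : Fin n → ℝ} (hy : y ∈ U)
    (hg : IsUnit (Matrix.of fun i j => g i j y).det) (i j k : Fin n) :
    c i j k y = c' i j k y := by
  have h₁ : SmoothPeriodic (fun _ : ℝ => (1 : ℝ)) := SmoothPeriodic.const 1
  have hs := smoothPeriodic_sinLoop 1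
  have hc := smoothPeriodic_cosLoop 1
  have hw : (2 * Real.pi) ^ 3 / 2 ≠ 0 := by positivity
  set D : Fin n → Fin n → Fin n → ℝ := fun i j k =>
    ∑ m, c i j m y * g m k y - ∑ m, c' i j m y * g m k y with hD
  have hcyc : ∀ i j k, D i j k + D k i j = 0 := by
    intro i j k
    have e := h.cyclic (h₁.smul_const (Pi.single i (1 : ℝ))) (hs.smul_const (Pi.single j (1 : ℝ)))
      (hc.smul_const (Pi.single k (1 : ℝ))) (isLoop_const hy)
    have e' := h'.cyclic (h₁.smul_const (Pi.single i (1 : ℝ)))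
      (hs.smul_const (Pi.single j (1 : ℝ))) (hc.smul_const (Pi.single k (1 : ℝ)))
      (isLoop_const hy)
    -- The variations of the first order operator for the two pencils become literally equal, so
    -- they cancel in `e' - e`, as do the terms in the derivative of `a`.
    simp only [mixedPairing, variationPairing_const_congr (firstOrderSymbol g b) a
      (fun i j k y => 2 * c' i j k y) c' (fun i j k y => 2 * c i j k y) c c₂' c₂] at e e'
    rw [h.variationPairing_second_first hy hs hc, h.variationPairing_second_first hy hc h₁,
      h.variationPairing_second_first hy h₁ hs, trilinearIntegral_one_sin_cos,
      trilinearIntegral_sin_cos_one, trilinearIntegral_cos_one_sin] at e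
    rw [h'.variationPairing_second_first hy hs hc, h'.variationPairing_second_first hy hc h₁,
      h'.variationPairing_second_first hy h₁ hs, trilinearIntegral_one_sin_cos,
      trilinearIntegral_sin_cos_one, trilinearIntegral_cos_one_sin] at e'
    refine (mul_eq_zero.1 (?_ : (2 * Real.pi) ^ 3 / 2 * (D i j k + D k i j) = 0)).resolve_left hw
    simp only [hD]
    linear_combination e' - e
  have hswap : ∀ i j k, D i j k - D j i k = 0 := by
    intro i j k
    have e := h.swap (h₁.smul_const (Pi.single i (1 : ℝ))) (hs.smul_const (Pi.single j (1 : ℝ)))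
      (hc.smul_const (Pi.single k (1 : ℝ))) (isLoop_const hy)
    have e' := h'.swap (h₁.smul_const (Pi.single i (1 : ℝ)))
      (hs.smul_const (Pi.single j (1 : ℝ))) (hc.smul_const (Pi.single k (1 : ℝ)))
      (isLoop_const hy)
    simp only [mixedPairing, variationPairing_const_congr (firstOrderSymbol g b) a
      (fun i j k y => 2 * c' i j k y) c' (fun i j k y => 2 * c i j k y) c c₂' c₂] at e e'
    rw [h.variationPairing_second_first hy hs hc, h.variationPairing_second_first hy h₁ hc,
      trilinearIntegral_one_sin_cos, trilinearIntegral_sin_one_cos] at e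
    rw [h'.variationPairing_second_first hy hs hc, h'.variationPairing_second_first hy h₁ hc,
      trilinearIntegral_one_sin_cos, trilinearIntegral_sin_one_cos] at e'
    refine (mul_eq_zero.1 (?_ : (2 * Real.pi) ^ 3 / 2 * (D i j k - D j i k) = 0)).resolve_left hw
    simp only [hD]
    linear_combination e' - e
  -- Already `D i j k = -D k i j = D j k i = -D i j k`.
  have hzero : ∀ k, D i j k = 0 := fun k => by
    linarith [hcyc i j k, hcyc j k i, hcyc k i j, hswap i j k, hswap j k i, hswap k i j]
  have hv := cancel_metric (v := fun m => c i j m y - c' i j m y) hg fun k => by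
    simpa [hD, sub_mul] using hzero k
  exact sub_eq_zero.1 (congrFun hv k)

/-- In flat coordinates the coefficients `c^{ij}_k` are first derivatives of `a^{ij}`. -/
theorem coefficient_eq (h : IsHamiltonianPencil U g b a c₂ c)
    (hg₀ : ∀ i j, ∀ y ∈ U, fderiv ℝ (g i j) y = 0) (hb₀ : ∀ i j k, ∀ y ∈ U, b i j k y = 0)
    {y : Fin n → ℝ} (hy : y ∈ U) (i j k : Fin n) :
    ∑ m, c i j m y * g m k y = fderiv ℝ (a i k) y (fun m => g m j y) := by
  have h₁ : SmoothPeriodic (fun _ : ℝ => (1 : ℝ)) := SmoothPeriodic.const 1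
  have hs := smoothPeriodic_sinLoop 1
  have hc := smoothPeriodic_cosLoop 1
  have hs₂ := smoothPeriodic_sinLoop 2
  have hw : (2 * Real.pi) ^ 3 / 2 ≠ 0 := by positivity
  have hz : ∀ p q r : ℝ → Fin n → ℝ, mixedPairing (firstOrderSymbol g b)
      (secondOrderSymbol a (fun i j k y => 2 * c i j k y) c₂ c) p q r (fun _ => y) =
      variationPairing (secondOrderSymbol a (fun i j k y => 2 * c i j k y) c₂ c)
        (firstOrderSymbol g b) p q r (fun _ => y) := by
    intro p q r
    rw [mixedPairing, variationPairing_eq_zero_of_const h.isOpen h.smooth_g h.smooth_b hg₀ hb₀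
      p q r (isLoop_const hy), zero_add]
  set A : Fin n → Fin n → Fin n → ℝ := fun i j k => fderiv ℝ (a i j) y (fun m => g m k y) with hA
  set C : Fin n → Fin n → Fin n → ℝ := fun i j k => ∑ m, c i j m y * g m k y with hC
  have hT : ∀ {p q r : ℝ → ℝ} (_ : SmoothPeriodic q) (_ : SmoothPeriodic r) (i j k : Fin n),
      mixedPairing (firstOrderSymbol g b)
        (secondOrderSymbol a (fun i j k y => 2 * c i j k y) c₂ c) (fun x => p x • Pi.single i 1)
        (fun x => q x • Pi.single j 1) (fun x => r x • Pi.single k 1) (fun _ => y) =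
      trilinearIntegral (A i j k) (2 * C i j k) (C i j k) p q r := fun hq hr i j k => by
    rw [hz, h.variationPairing_second_first hy hq hr]
  have hcyc : ∀ i j k, A i j k - C i j k - C k i j = 0 := by
    intro i j k
    have e := h.cyclic (h₁.smul_const (Pi.single i (1 : ℝ))) (hs.smul_const (Pi.single j (1 : ℝ)))
      (hc.smul_const (Pi.single k (1 : ℝ))) (isLoop_const hy)
    rw [hT hs hc, hT hc h₁, hT h₁ hs, trilinearIntegral_one_sin_cos,
      trilinearIntegral_sin_cos_one, trilinearIntegral_cos_one_sin] at e
    refine (mul_eq_zero.1 (?_ : (2 * Real.pi) ^ 3 / 2 * _ = 0)).resolve_left hw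
    linear_combination e
  have hswap : ∀ i j k, A i j k - C i j k + C j i k = 0 := by
    intro i j k
    have e := h.swap (h₁.smul_const (Pi.single i (1 : ℝ))) (hs.smul_const (Pi.single j (1 : ℝ)))
      (hc.smul_const (Pi.single k (1 : ℝ))) (isLoop_const hy)
    rw [hT hs hc, hT h₁ hc, trilinearIntegral_one_sin_cos, trilinearIntegral_sin_one_cos] at e
    refine (mul_eq_zero.1 (?_ : (2 * Real.pi) ^ 3 / 2 * _ = 0)).resolve_left hw
    linear_combination e
  -- Test functions of frequencies 1, 1, 2 add independent information: modulo `hcyc` this relation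
  -- says `C i j k + C j k i + C k i j = 0`.
  have hquad : ∀ i j k, -A i j k + 2 * A j k i - 3 / 2 * C j k i
      + (A k i j + 3 * C k i j) / 2 = 0 := by
    intro i j k
    have e := h.cyclic (hc.smul_const (Pi.single i (1 : ℝ))) (hc.smul_const (Pi.single j (1 : ℝ)))
      (hs₂.smul_const (Pi.single k (1 : ℝ))) (isLoop_const hy)
    rw [hT hc hs₂, hT hs₂ hc, hT hc hc, trilinearIntegral_cos_cos_sin,
      trilinearIntegral_cos_sin_cos, trilinearIntegral_sin_cos_cos] at e
    refine (mul_eq_zero.1 (?_ : (2 * Real.pi) ^ 3 / 2 * _ = 0)).resolve_left hw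
    linear_combination e
  change C i j k = A i k j
  -- `hcyc` and `hswap` make `C` skew in its first and third indices. Then `A i k j = C i k j - C k
  -- i j = -C j k i - C k i j`, which equals `C i j k` by the cyclic relation.
  linarith [hcyc i j k, hcyc j k i, hcyc k i j, hcyc i k j, hcyc k j i, hcyc j i k, hswap i j k,
    hswap j k i, hswap k i j, hswap i k j, hswap k j i, hswap j i k, hquad i j k]

end IsHamiltonianPencil

end LoopSpace

namespace LoopSpace

/-! ### Variations along oscillating loops -/

variable {n : ℕ} {U : Set (Fin n → ℝ)}

/-- The loop `y + t cos (2π x) e`. -/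
noncomputable def oscillatingLoop (y e : Fin n → ℝ) (t x : ℝ) : Fin n → ℝ :=
  y + (t * cosLoop 1 x) • e

theorem abs_cosLoop_le_one (m : ℕ) (x : ℝ) : |cosLoop m x| ≤ 1 := Real.abs_cos_le_one _

theorem isLoop_oscillatingLoop {y e : Fin n → ℝ} {ρ t : ℝ} (hρ : ∀ s, |s| ≤ ρ → y + s • e ∈ U)
    (ht : |t| ≤ ρ) : IsLoop U (oscillatingLoop y e t) where
  smooth := contDiff_const.add
    ((contDiff_const.mul (smoothPeriodic_cosLoop 1).smooth).smul contDiff_const)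
  periodic x := by simp only [oscillatingLoop, (smoothPeriodic_cosLoop 1).periodic x]
  mem x := by
    refine hρ _ ?_
    rw [abs_mul]
    exact (mul_le_of_le_one_right (abs_nonneg t) (abs_cosLoop_le_one 1 x)).trans ht

theorem deriv_oscillatingLoop (y e : Fin n → ℝ) (t : ℝ) :
    deriv (oscillatingLoop y e t) = fun x => (t * deriv (cosLoop 1) x) • e := by
  funext x
  have h := ((((smoothPeriodic_cosLoop 1).differentiable x).hasDerivAt.const_mul t).smul_const
    e).const_add y
  exact h.deriv

theorem iteratedDeriv_two_oscillatingLoop (y e : Fin n → ℝ) (t x : ℝ) :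
    iteratedDeriv 2 (oscillatingLoop y e t) x = (t * iteratedDeriv 2 (cosLoop 1) x) • e := by
  rw [iteratedDeriv_succ, iteratedDeriv_one, deriv_oscillatingLoop, iteratedDeriv_succ,
    iteratedDeriv_one]
  exact ((((smoothPeriodic_cosLoop 1).deriv.differentiable x).hasDerivAt.const_mul t).smul_const
    e).deriv

/-- With `b = 0` the first order operator kills constant fields, so the direction of variation is
zero. -/
theorem variationPairing_of_const_right (Φ : JetSymbol n) {g : Fin n → Fin n → (Fin n → ℝ) → ℝ}
    {b : Fin n → Fin n → Fin n → (Fin n → ℝ) → ℝ} (hb₀ : ∀ i j k, ∀ y ∈ U, b i j k y = 0)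
    (p q : ℝ → Fin n → ℝ) (v : Fin n → ℝ) {u : ℝ → Fin n → ℝ} (hu : IsLoop U u) :
    variationPairing Φ (firstOrderSymbol g b) p q (fun _ => v) u = 0 := by
  have h : (fun x => firstOrderSymbol g b (jet 2 u x) (jet 2 (fun _ => v) x)) = fun _ => 0 := by
    funext x i
    simp [firstOrderSymbol, jet_const_one, hb₀ _ _ _ _ (hu.jet_mem 2 _)]
  have h₂ : ∀ x, jet 2 (fun _ : ℝ => (0 : Fin n → ℝ)) x = 0 := fun x => by
    ext s
    simp [jet]
  rw [variationPairing, h]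
  simp [h₂]

/-- If the variations of `∫ (R u_x u_x + F u_{xx}) dx` along all loops oscillating about `y` in the
direction `e` vanish, then `R(e, e) = ∂_e F(e)` at `y`. Here `S` and `G` are the derivatives of `R`
and `F` along `e`. -/
theorem eq_of_oscillating_variation (hU : IsOpen U) {R F S G : (Fin n → ℝ) → ℝ}
    (hR : ContinuousOn R U) (hF : ContDiffOn ℝ ∞ F U) (hS : ContinuousOn S U)
    {y e : Fin n → ℝ} (hG : ∀ z ∈ U, fderiv ℝ F z e = G z) {ρ : ℝ} (hρ₀ : 0 < ρ)
    (hρ : ∀ s, |s| ≤ ρ → y + s • e ∈ U)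
    (h : ∀ t, |t| ≤ ρ → ∫ x in (0 : ℝ)..1,
      (t ^ 2 * (cosLoop 1 x * deriv (cosLoop 1) x ^ 2 * S (oscillatingLoop y e t x))
      + 2 * t * (deriv (cosLoop 1) x ^ 2 * R (oscillatingLoop y e t x))
      + t * (cosLoop 1 x * iteratedDeriv 2 (cosLoop 1) x * G (oscillatingLoop y e t x))
      + F (oscillatingLoop y e t x) * iteratedDeriv 2 (cosLoop 1) x) = 0) :
    R y = G y := by
  have hGc : ContinuousOn G U := by
    have h₁ : ContinuousOn (fun z => fderiv ℝ F z e) U :=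
      (hF.continuousOn_fderiv_of_isOpen hU (by simp)).clm_apply continuousOn_const
    exact h₁.congr fun z hz => (hG z hz).symm
  have hc := smoothPeriodic_cosLoop 1
  have hmem : ∀ τ x, oscillatingLoop y e (ρ * Real.sin τ) x ∈ U := fun τ x => by
    refine (isLoop_oscillatingLoop hρ ?_).mem x
    rw [abs_mul, abs_of_pos hρ₀]
    exact mul_le_of_le_one_right hρ₀.le (Real.abs_sin_le_one τ)
  have hcont : Continuous fun z : ℝ × ℝ => oscillatingLoop y e (ρ * Real.sin z.1) z.2 := by
    have := hc.continuous
    unfold oscillatingLoop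
    fun_prop
  have hcomp : ∀ {K : (Fin n → ℝ) → ℝ}, ContinuousOn K U →
      Continuous fun z : ℝ × ℝ => K (oscillatingLoop y e (ρ * Real.sin z.1) z.2) := fun hK =>
    hK.comp_continuous hcont fun z => hmem z.1 z.2
  have hcx : Continuous fun z : ℝ × ℝ => cosLoop 1 z.2 := hc.continuous.comp continuous_snd
  have hc₁ : Continuous fun z : ℝ × ℝ => deriv (cosLoop 1) z.2 :=
    hc.deriv.continuous.comp continuous_snd
  have hc₂ : Continuous fun z : ℝ × ℝ => iteratedDeriv 2 (cosLoop 1) z.2 :=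
    (hc.iteratedDeriv 2).continuous.comp continuous_snd
  -- The integrand is the given one after integrating `F` by parts and dividing by `t`. Setting `t =
  -- ρ sin τ` keeps the loop in `U` for every real `τ`, so continuity holds on the whole line.
  have hΨ : Continuous fun τ : ℝ => ∫ x in (0 : ℝ)..1,
      (ρ * Real.sin τ * (cosLoop 1 x * deriv (cosLoop 1) x ^ 2
        * S (oscillatingLoop y e (ρ * Real.sin τ) x))
      + 2 * (deriv (cosLoop 1) x ^ 2 * R (oscillatingLoop y e (ρ * Real.sin τ) x))
      + (cosLoop 1 x * iteratedDeriv 2 (cosLoop 1) x - deriv (cosLoop 1) x ^ 2)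
        * G (oscillatingLoop y e (ρ * Real.sin τ) x)) := by
    refine intervalIntegral.continuous_parametric_intervalIntegral_of_continuous' ?_ 0 1
    have hs : Continuous fun z : ℝ × ℝ => ρ * Real.sin z.1 := by fun_prop
    exact ((hs.mul ((hcx.mul (hc₁.pow 2)).mul (hcomp hS))).add
      (continuous_const.mul ((hc₁.pow 2).mul (hcomp hR)))).add
      (((hcx.mul hc₂).sub (hc₁.pow 2)).mul (hcomp hGc))
  have hzero : ∀ τ ∈ Set.Ioo 0 Real.pi, ∫ x in (0 : ℝ)..1,
      (ρ * Real.sin τ * (cosLoop 1 x * deriv (cosLoop 1) x ^ 2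
        * S (oscillatingLoop y e (ρ * Real.sin τ) x))
      + 2 * (deriv (cosLoop 1) x ^ 2 * R (oscillatingLoop y e (ρ * Real.sin τ) x))
      + (cosLoop 1 x * iteratedDeriv 2 (cosLoop 1) x - deriv (cosLoop 1) x ^ 2)
        * G (oscillatingLoop y e (ρ * Real.sin τ) x)) = 0 := by
    intro τ hτ
    set t := ρ * Real.sin τ with ht
    have ht₀ : t ≠ 0 := mul_ne_zero hρ₀.ne' (Real.sin_pos_of_pos_of_lt_pi hτ.1 hτ.2).ne'
    have ht₁ : |t| ≤ ρ := by
      rw [ht, abs_mul, abs_of_pos hρ₀]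
      exact mul_le_of_le_one_right hρ₀.le (Real.abs_sin_le_one τ)
    have hu := isLoop_oscillatingLoop hρ ht₁
    have hFu : SmoothPeriodic fun x => F (oscillatingLoop y e t x) :=
      ⟨hF.comp_contDiff hu.smooth hu.mem, fun x => by simp only [hu.periodic x]⟩
    have hFd : ∀ x, deriv (fun x => F (oscillatingLoop y e t x)) x =
        t * deriv (cosLoop 1) x * G (oscillatingLoop y e t x) := by
      intro x
      have h₁ : HasFDerivAt F _ (oscillatingLoop y e t x) :=
        ((hF.contDiffAt (hU.mem_nhds (hu.mem x))).differentiableAt (by simp)).hasFDerivAt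
      have h₂ := (hu.smoothPeriodic.differentiable x).hasDerivAt
      rw [deriv_oscillatingLoop] at h₂
      have h₃ := (h₁.comp_hasDerivAt x h₂).deriv
      rw [map_smul, hG _ (hu.mem x), smul_eq_mul] at h₃
      exact h₃
    have hibp := hFu.integral_deriv_mul hc.deriv
    have hcu : ∀ {K : (Fin n → ℝ) → ℝ}, ContinuousOn K U →
        Continuous fun x => K (oscillatingLoop y e t x) := fun hK =>
      hK.comp_continuous hu.smooth.continuous hu.mem
    have hd₀ := hc.continuous
    have hd₁ := hc.deriv.continuous
    have hd₂ := (hc.iteratedDeriv 2).continuous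
    have hSu := hcu hS
    have hRu := hcu hR
    have hGu := hcu hGc
    have hFu' := hFu.continuous
    have hX₁ : Continuous fun x =>
        t ^ 2 * (cosLoop 1 x * deriv (cosLoop 1) x ^ 2 * S (oscillatingLoop y e t x))
        + 2 * t * (deriv (cosLoop 1) x ^ 2 * R (oscillatingLoop y e t x))
        + t * (cosLoop 1 x * iteratedDeriv 2 (cosLoop 1) x * G (oscillatingLoop y e t x)) :=
      ((continuous_const.mul ((hd₀.mul (hd₁.pow 2)).mul hSu)).add
        (continuous_const.mul ((hd₁.pow 2).mul hRu))).add
        (continuous_const.mul ((hd₀.mul hd₂).mul hGu))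
    have hX₂ : Continuous fun x => t * deriv (cosLoop 1) x * G (oscillatingLoop y e t x)
        * deriv (cosLoop 1) x := ((continuous_const.mul hd₁).mul hGu).mul hd₁
    have e₁ := h t ht₁
    have hi₂ : IntervalIntegrable (fun x => F (oscillatingLoop y e t x)
        * iteratedDeriv 2 (cosLoop 1) x) MeasureTheory.volume 0 1 :=
      (hFu'.mul hd₂).intervalIntegrable _ _
    rw [intervalIntegral.integral_add (hX₁.intervalIntegrable _ _) hi₂] at e₁
    have e₂ : ∫ x in (0 : ℝ)..1, F (oscillatingLoop y e t x) * iteratedDeriv 2 (cosLoop 1) x =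
        -∫ x in (0 : ℝ)..1, t * deriv (cosLoop 1) x * G (oscillatingLoop y e t x)
          * deriv (cosLoop 1) x := by
      simp only [hFd] at hibp
      rw [hibp, neg_neg]
      refine intervalIntegral.integral_congr fun x _ => ?_
      simp only [iteratedDeriv_succ, iteratedDeriv_zero]
    rw [e₂, ← sub_eq_add_neg, ← intervalIntegral.integral_sub
      (hX₁.intervalIntegrable _ _) (hX₂.intervalIntegrable _ _)] at e₁
    refine (mul_eq_zero.1 (?_ : t * _ = 0)).resolve_left ht₀
    rw [← intervalIntegral.integral_const_mul]
    refine Eq.trans ?_ e₁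
    refine intervalIntegral.integral_congr fun x _ => ?_
    ring
  -- Division by `t` gave zero only for `τ` in `(0, π)`; continuity carries it to `τ = 0`, where the
  -- loop is constant.
  have hlim₁ := (hΨ.tendsto 0).mono_left (nhdsWithin_le_nhds (s := Set.Ioi 0))
  have hlim₂ := tendsto_nhds_unique hlim₁ (tendsto_const_nhds.congr' (by
    filter_upwards [Ioo_mem_nhdsGT Real.pi_pos] with τ hτ using (hzero τ hτ).symm))
  have hval : ∀ x, oscillatingLoop y e 0 x = y := fun x => by simp [oscillatingLoop]
  simp only [Real.sin_zero, mul_zero, zero_mul, zero_add, hval] at hlim₂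
  -- Both `cos²` and `sin²` have mean 1/2, so `2 R` contributes `R` and the two terms in `G` add up
  -- to `-G`.
  have hint := integral_of_eq_cos (α := (2 * Real.pi) ^ 2 * (R y - G y))
    (β := -((2 * Real.pi) ^ 2 * R y)) (γ := 0)
    (f := fun x => 2 * (deriv (cosLoop 1) x ^ 2 * R y)
      + (cosLoop 1 x * iteratedDeriv 2 (cosLoop 1) x - deriv (cosLoop 1) x ^ 2) * G y) fun x => by
    rw [deriv_cosLoop, iteratedDeriv_two_cosLoop]
    push_cast
    linear_combination (2 * Real.pi) ^ 2 * (2 * R y - G y) * sinLoop_one_sq x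
      - (2 * Real.pi) ^ 2 * G y * cosLoop_one_sq x
  rw [hint] at hlim₂
  have hw : (2 * Real.pi) ^ 2 ≠ 0 := by positivity
  exact sub_eq_zero.1 ((mul_eq_zero.1 hlim₂).resolve_left hw)

/-! ### The terms quadratic in `u_x` -/

namespace IsHamiltonianPencil

variable {g a : Fin n → Fin n → (Fin n → ℝ) → ℝ} {b c : Fin n → Fin n → Fin n → (Fin n → ℝ) → ℝ}
  {c₂ : Fin n → Fin n → Fin n → Fin n → (Fin n → ℝ) → ℝ}

/-- Two constant test fields and a third one mapped by `g d/dx` to `cos (2π x) e` make the cyclic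
sum the variation, within the family `y + t cos (2π x) e`, of `∫ (c₂ u_x u_x + c u_{xx}) dx`. -/
theorem quadratic_form_eq (h : IsHamiltonianPencil U g b a c₂ c)
    (hg₀ : ∀ i j, ∀ y ∈ U, fderiv ℝ (g i j) y = 0) (hb₀ : ∀ i j k, ∀ y ∈ U, b i j k y = 0)
    {y : Fin n → ℝ} (hy : y ∈ U) (hg : IsUnit (Matrix.of fun i j => g i j y).det) (i j : Fin n)
    (e : Fin n → ℝ) :
    ∑ k, ∑ l, c₂ i j k l y * e k * e l = ∑ k, fderiv ℝ (c i j k) y e * e k := by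
  obtain ⟨ε, hε, hball⟩ := Metric.isOpen_iff.1 h.isOpen y hy
  obtain ⟨ρ, hρ₀, hρ'⟩ : ∃ ρ > 0, ∀ s : ℝ, |s| ≤ ρ → y + s • e ∈ Metric.ball y ε := by
    -- The added 1 keeps the denominator positive when `e = 0`.
    refine ⟨ε / (2 * (‖e‖ + 1)), by positivity, fun s hs => ?_⟩
    rw [mem_ball_iff_norm, add_sub_cancel_left, norm_smul, Real.norm_eq_abs]
    calc |s| * ‖e‖ ≤ ε / (2 * (‖e‖ + 1)) * (‖e‖ + 1) := by gcongr; linarith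
      _ = ε / 2 := by field_simp
      _ < ε := by linarith
  have hρ : ∀ s : ℝ, |s| ≤ ρ → y + s • e ∈ U := fun s hs => hball (hρ' s hs)
  have hgc : ∀ i j, ∀ z ∈ Metric.ball y ε, g i j z = g i j y := fun i j z hz =>
    Metric.isOpen_ball.is_const_of_fderiv_eq_zero (convex_ball y ε).isPreconnected
      (((h.smooth_g i j).differentiableOn (by simp)).mono hball) (fun w hw => hg₀ i j w (hball hw))
      hz (Metric.mem_ball_self hε)
  -- Chosen so that `g v = e / (2π)`; the factor `2π` from differentiating the sine then cancels.
  set v : Fin n → ℝ := (Matrix.of fun i j => g i j y)⁻¹.mulVec ((2 * Real.pi)⁻¹ • e) with hv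
  have hgv : ∀ m, ∑ l, g m l y * v l = (2 * Real.pi)⁻¹ * e m := by
    intro m
    have h₁ : (Matrix.of fun i j => g i j y).mulVec v = (2 * Real.pi)⁻¹ • e := by
      rw [hv, Matrix.mulVec_mulVec, Matrix.mul_nonsing_inv _ hg, Matrix.one_mulVec]
    exact congrFun h₁ m
  have hc := smoothPeriodic_cosLoop 1
  refine eq_of_oscillating_variation h.isOpen (F := fun z => ∑ k, c i j k z * e k)
    (R := fun z => ∑ k, ∑ l, c₂ i j k l z * e k * e l)
    (S := fun z => ∑ k, ∑ l, fderiv ℝ (c₂ i j k l) z e * e k * e l)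
    (G := fun z => ∑ k, fderiv ℝ (c i j k) z e * e k) ?_ ?_ ?_ ?_ hρ₀ hρ ?_
  · exact continuousOn_finsetSum _ fun k _ => continuousOn_finsetSum _ fun l _ =>
      ((h.smooth_c₂ i j k l).continuousOn.mul continuousOn_const).mul continuousOn_const
  · exact ContDiffOn.sum fun k _ => (h.smooth_c i j k).mul contDiffOn_const
  · exact continuousOn_finsetSum _ fun k _ => continuousOn_finsetSum _ fun l _ =>
      ((((h.smooth_c₂ i j k l).continuousOn_fderiv_of_isOpen h.isOpen (by simp)).clm_apply
        continuousOn_const).mul continuousOn_const).mul continuousOn_const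
  · intro z hz
    have h₁ : HasFDerivAt (fun z => ∑ k, c i j k z * e k)
        (∑ k, e k • fderiv ℝ (c i j k) z) z := by
      refine HasFDerivAt.fun_sum fun k _ => HasFDerivAt.mul_const ?_ _
      exact (((h.smooth_c i j k).contDiffAt (h.isOpen.mem_nhds hz)).differentiableAt
        (by simp)).hasFDerivAt
    rw [h₁.fderiv]
    simp [mul_comm]
  · intro t ht
    have hu := isLoop_oscillatingLoop hρ ht
    have hub : ∀ x, oscillatingLoop y e t x ∈ Metric.ball y ε :=
      (isLoop_oscillatingLoop hρ' ht).mem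
    have hi := SmoothPeriodic.const (Pi.single i 1 : Fin n → ℝ)
    have hj := SmoothPeriodic.const (Pi.single j 1 : Fin n → ℝ)
    have e₁ := h.cyclic hi hj ((smoothPeriodic_sinLoop 1).smul_const v) hu
    -- Of the six terms only the variation of the second order operator along the image of the sine
    -- field survives.
    simp only [mixedPairing, variationPairing_eq_zero_of_const h.isOpen h.smooth_g h.smooth_b hg₀
      hb₀ _ _ _ hu, variationPairing_of_const_right _ hb₀ _ _ _ hu, add_zero, zero_add] at e₁
    have h₁ : (fun x => firstOrderSymbol g b (jet 2 (oscillatingLoop y e t) x)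
        (jet 2 (fun x => sinLoop 1 x • v) x)) = fun x => cosLoop 1 x • e := by
      funext x m
      simp only [firstOrderSymbol, jet_zero, hb₀ _ _ _ _ (hu.mem x), zero_mul, Finset.sum_const_zero,
        add_zero, hgc _ _ _ (hub x), jet_smul_const (smoothPeriodic_sinLoop 1)]
      simp only [Fin.val_one, iteratedDeriv_one, Pi.smul_apply, smul_eq_mul, deriv_sinLoop]
      rw [Finset.sum_congr rfl fun l _ => mul_left_comm (g m l y) _ (v l), ← Finset.mul_sum, hgv]
      have := Real.pi_ne_zero
      push_cast
      field_simp
    rw [variationPairing, h₁] at e₁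
    refine Eq.trans ?_ e₁
    refine intervalIntegral.integral_congr fun x _ => ?_
    have hη₁ : jet 2 (fun _ : ℝ => (Pi.single j 1 : Fin n → ℝ)) x 1 = 0 := jet_const_one _ _
    have hη₂ : jet 2 (fun _ : ℝ => (Pi.single j 1 : Fin n → ℝ)) x 2 = 0 := jet_const_two _ _
    simp only [fderiv_secondOrderSymbol h.isOpen h.smooth_a h.smooth_two_mul h.smooth_c₂
      h.smooth_c (hu.jet_mem 2 _), hη₁, hη₂, jet_zero, jet_apply_one, jet_apply_two,
      jet_smul_const hc, deriv_oscillatingLoop, iteratedDeriv_two_oscillatingLoop]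
    simp only [Pi.single_apply, Pi.zero_apply, mul_zero, zero_add, Finset.sum_const_zero,
      mul_ite, ite_mul, mul_one, one_mul, zero_mul, Finset.sum_ite_irrel, Finset.sum_add_distrib,
      Finset.sum_ite_eq', Finset.mem_univ, if_true, map_smul, Pi.smul_apply, smul_eq_mul,
      Fin.val_zero, Fin.val_one, Fin.val_two, iteratedDeriv_zero, iteratedDeriv_one, add_mul,
      Finset.mul_sum, Finset.sum_mul]
    simp only [← Finset.sum_add_distrib]
    refine Finset.sum_congr rfl fun k _ => ?_
    rw [add_assoc]
    refine congrArg₂ _ (Finset.sum_congr rfl fun l _ => ?_) ?_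
    · ring
    · ring

/-- In flat coordinates the coefficients `c^{ij}_{kl}` are the symmetrised derivatives of
`c^{ij}_k`. -/
theorem quadratic_coefficient_eq (h : IsHamiltonianPencil U g b a c₂ c)
    (hg₀ : ∀ i j, ∀ y ∈ U, fderiv ℝ (g i j) y = 0) (hb₀ : ∀ i j k, ∀ y ∈ U, b i j k y = 0)
    {y : Fin n → ℝ} (hy : y ∈ U) (hg : IsUnit (Matrix.of fun i j => g i j y).det)
    (hsymm : ∀ i j k l, c₂ i j k l y = c₂ i j l k y) (i j k l : Fin n) :
    c₂ i j k l y = 1 / 2 * (fderiv ℝ (c i j k) y (Pi.single l 1)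
      + fderiv ℝ (c i j l) y (Pi.single k 1)) := by
  -- Polarisation over the basis vectors `e_k`, `e_l` and their sum.
  have hq := h.quadratic_form_eq hg₀ hb₀ hy hg i j
  have hk := hq (Pi.single k 1)
  have hl := hq (Pi.single l 1)
  have hkl := hq (Pi.single k 1 + Pi.single l 1)
  simp only [Pi.add_apply, mul_add, Finset.sum_add_distrib, map_add, Pi.single_apply,
    mul_ite, mul_one, mul_zero, Finset.sum_ite_eq', Finset.mem_univ, if_true]
    at hk hl hkl
  linarith [hsymm i j k l]

end IsHamiltonianPencil

end LoopSpace

/-! ### Inverse matrices with smooth entries -/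

theorem contDiffOn_det {E : Type*} [NormedAddCommGroup E] [NormedSpace ℝ E] {n : ℕ} {s : Set E}
    {A : E → Matrix (Fin n) (Fin n) ℝ} (hA : ∀ i j, ContDiffOn ℝ ∞ (fun x => A x i j) s) :
    ContDiffOn ℝ ∞ (fun x => (A x).det) s := by
  simp only [Matrix.det_apply']
  exact ContDiffOn.sum fun σ _ => contDiffOn_const.mul (contDiffOn_prod fun i _ => hA _ _)

theorem contDiffOn_matrix_inv {E : Type*} [NormedAddCommGroup E] [NormedSpace ℝ E] {n : ℕ}
    {s : Set E} {A : E → Matrix (Fin n) (Fin n) ℝ} (hA : ∀ i j, ContDiffOn ℝ ∞ (fun x => A x i j) s)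
    (hdet : ∀ x ∈ s, IsUnit (A x).det) (i j : Fin n) :
    ContDiffOn ℝ ∞ (fun x => (A x)⁻¹ i j) s := by
  simp only [Matrix.inv_def, Matrix.smul_apply, Matrix.adjugate_apply, Ring.inverse_eq_inv',
    smul_eq_mul]
  refine ((contDiffOn_det hA).inv fun x hx => (hdet x hx).ne_zero).mul (contDiffOn_det fun k l => ?_)
  simp only [Matrix.updateRow_apply]
  split_ifs
  · exact contDiffOn_const
  · exact hA k l

/-- A matrix with vanishing derivative has an inverse with vanishing derivative. -/
theorem fderiv_matrix_inv_eq_zero {E : Type*} [NormedAddCommGroup E] [NormedSpace ℝ E] {n : ℕ}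
    {s : Set E} (hs : IsOpen s) {A : E → Matrix (Fin n) (Fin n) ℝ}
    (hA : ∀ i j, ContDiffOn ℝ ∞ (fun x => A x i j) s) (hdet : ∀ x ∈ s, IsUnit (A x).det)
    {x : E} (hx : x ∈ s) (h₀ : ∀ i j, fderiv ℝ (fun x => A x i j) x = 0) (i j : Fin n) :
    fderiv ℝ (fun x => (A x)⁻¹ i j) x = 0 := by
  have hd : ∀ i j, HasFDerivAt (fun x => (A x)⁻¹ i j) (fderiv ℝ (fun x => (A x)⁻¹ i j) x) x :=
    fun i j => (((contDiffOn_matrix_inv hA hdet i j).contDiffAt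
      (hs.mem_nhds hx)).differentiableAt (by simp)).hasFDerivAt
  have hdA : ∀ i j, HasFDerivAt (fun x => A x i j) (0 : E →L[ℝ] ℝ) x := fun i j => by
    rw [← h₀ i j]
    exact (((hA i j).contDiffAt (hs.mem_nhds hx)).differentiableAt (by simp)).hasFDerivAt
  ext v
  have key : (Matrix.of fun i j => fderiv ℝ (fun x => (A x)⁻¹ i j) x v) * A x = 0 := by
    ext i k
    have h₁ : HasFDerivAt (fun x => ∑ j, (A x)⁻¹ i j * A x j k)
        (∑ j, ((A x)⁻¹ i j • (0 : E →L[ℝ] ℝ)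
          + A x j k • fderiv ℝ (fun x => (A x)⁻¹ i j) x)) x :=
      HasFDerivAt.fun_sum fun j _ => (hd i j).fun_mul (hdA j k)
    -- The product rule is applied to `A⁻¹ A = 1`, valid near `x`; the term with the derivative of
    -- `A` is zero.
    have h₂ : (fun x => ∑ j, (A x)⁻¹ i j * A x j k) =ᶠ[nhds x]
        fun _ => (1 : Matrix (Fin n) (Fin n) ℝ) i k := by
      filter_upwards [hs.mem_nhds hx] with z hz
      rw [← Matrix.nonsing_inv_mul (A z) (hdet z hz), Matrix.mul_apply]
    have h₃ := (h₁.congr_of_eventuallyEq h₂.symm).unique (hasFDerivAt_const _ x)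
    have h₄ := congrArg (fun L => L v) h₃
    simp only [smul_zero, zero_add, sum_apply, smul_apply,
      smul_eq_mul, zero_apply] at h₄
    rw [Matrix.mul_apply, Matrix.zero_apply, ← h₄]
    exact Finset.sum_congr rfl fun j _ => mul_comm _ _
  have h := congrArg (fun B => B * (A x)⁻¹) key
  simp only [Matrix.mul_assoc, Matrix.mul_nonsing_inv _ (hdet x hx), Matrix.mul_one,
    Matrix.zero_mul] at h
  exact congrFun (congrFun h i) j

namespace TargetGeometry

open LoopSpace

/-! ### Coordinate fields and components -/

variable {n : ℕ} {M : Type*} [TopologicalSpace M] [ChartedSpace (Fin n → ℝ) M]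
  {φ : OpenPartialHomeomorph M (Fin n → ℝ)}

theorem mdifferentiable_of_mem_charts [IsManifold 𝓘(ℝ, Fin n → ℝ) ∞ M] (hφ : φ ∈ charts n M) :
    φ.MDifferentiable 𝓘(ℝ, Fin n → ℝ) 𝓘(ℝ, Fin n → ℝ) :=
  ⟨(contMDiffOn_of_mem_maximalAtlas hφ).mdifferentiableOn (by simp),
    (contMDiffOn_symm_of_mem_maximalAtlas hφ).mdifferentiableOn (by simp)⟩

/-- The derivative of a chart as a linear equivalence. -/
noncomputable def chartDeriv [IsManifold 𝓘(ℝ, Fin n → ℝ) ∞ M] (hφ : φ ∈ charts n M) {p : M}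
    (hp : p ∈ φ.source) : TangentSpace 𝓘(ℝ, Fin n → ℝ) p ≃L[ℝ] (Fin n → ℝ) :=
  (mdifferentiable_of_mem_charts hφ).mfderiv hp

theorem coordField_eq [IsManifold 𝓘(ℝ, Fin n → ℝ) ∞ M] (hφ : φ ∈ charts n M) {p : M}
    (hp : p ∈ φ.source) (i : Fin n) :
    coordField φ i p = (chartDeriv hφ hp).symm (Pi.single i 1) := by
  refine (VectorField.mpullback_apply ..).trans ?_
  exact congrArg (fun L => L (Pi.single i 1)) (ContinuousLinearMap.inverse_equiv (chartDeriv hφ hp))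

theorem sum_coordField [IsManifold 𝓘(ℝ, Fin n → ℝ) ∞ M] (hφ : φ ∈ charts n M) {p : M}
    (hp : p ∈ φ.source) (v : TangentSpace 𝓘(ℝ, Fin n → ℝ) p) :
    v = ∑ i, chartDeriv hφ hp v i • coordField φ i p := by
  simp only [coordField_eq hφ hp, ← map_smul, ← map_sum]
  rw [← (pi_eq_sum_univ' (chartDeriv hφ hp v))]
  simp

theorem isUnit_det_components [IsManifold 𝓘(ℝ, Fin n → ℝ) ∞ M]
    {B : (p : M) → TangentSpace 𝓘(ℝ, Fin n → ℝ) p →L[ℝ] TangentSpace 𝓘(ℝ, Fin n → ℝ) p →L[ℝ] ℝ}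
    (hB : ∀ p v, (∀ w, B p v w = 0) → v = 0) (hφ : φ ∈ charts n M) {y : Fin n → ℝ}
    (hy : y ∈ φ.target) : IsUnit (Matrix.of fun i j => components B φ i j y).det := by
  rw [isUnit_iff_ne_zero]
  intro h
  obtain ⟨w, hw, hw₀⟩ := Matrix.exists_vecMul_eq_zero_iff.2 h
  have hp := φ.map_target hy
  have h₁ : ∑ i, w i • coordField φ i (φ.symm y) = 0 := by
    refine hB _ _ fun z => ?_
    rw [sum_coordField hφ hp z]
    simp only [map_sum, map_smul, sum_apply, smul_apply,
      smul_eq_mul]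
    refine Finset.sum_eq_zero fun j _ => ?_
    have h₂ : ∑ i, w i * components B φ i j y = 0 := congrFun hw₀ j
    rw [show (∑ i, w i * B (φ.symm y) (coordField φ i (φ.symm y)) (coordField φ j (φ.symm y))) = 0 from h₂, mul_zero]
  refine hw ?_
  simp only [coordField_eq hφ hp, ← map_smul, ← map_sum] at h₁
  rw [← pi_eq_sum_univ' w] at h₁
  simpa using h₁

end TargetGeometry

/-! ### From coefficients in charts to the connection -/

namespace TargetGeometry

open LoopSpace

variable {n : ℕ} {M : Type*} [TopologicalSpace M] [ChartedSpace (Fin n → ℝ) M]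
  {φ : OpenPartialHomeomorph M (Fin n → ℝ)}

theorem contDiffOn_pd {U : Set (Fin n → ℝ)} (hU : IsOpen U) {F : (Fin n → ℝ) → ℝ}
    (hF : ContDiffOn ℝ ∞ F U) (i : Fin n) : ContDiffOn ℝ ∞ (pd i F) U :=
  (hF.fderiv_of_isOpen hU (by simp)).clm_apply contDiffOn_const

theorem fderiv_eq_sum_pd (F : (Fin n → ℝ) → ℝ) (y v : Fin n → ℝ) :
    fderiv ℝ F y v = ∑ s, v s * pd s F y := by
  conv_lhs => rw [pi_eq_sum_univ' v]
  simp only [map_sum, map_smul, smul_eq_mul, pd]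

theorem contDiffOn_contravariantSymbols {U : Set (Fin n → ℝ)} {a : Fin n → Fin n → (Fin n → ℝ) → ℝ}
    {Γ : Fin n → Fin n → Fin n → (Fin n → ℝ) → ℝ} (ha : ∀ i j, ContDiffOn ℝ ∞ (a i j) U)
    (hΓ : ∀ k i j, ContDiffOn ℝ ∞ (Γ k i j) U) (i j k : Fin n) :
    ContDiffOn ℝ ∞ (contravariantSymbols a Γ i j k) U :=
  (ContDiffOn.sum fun r _ => (ha i r).mul (hΓ j r k)).neg

/-- Lowering an index of the contravariant symbols recovers the Christoffel symbols. -/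
theorem eq_of_contravariantSymbols_eq {a : Fin n → Fin n → (Fin n → ℝ) → ℝ}
    {Γ Γ' : Fin n → Fin n → Fin n → (Fin n → ℝ) → ℝ} {y : Fin n → ℝ}
    (ha : IsUnit (Matrix.of fun i j => a i j y).det)
    (h : ∀ i j k, contravariantSymbols a Γ i j k y = contravariantSymbols a Γ' i j k y)
    (k i j : Fin n) : Γ k i j y = Γ' k i j y := by
  have h₁ : (Matrix.of fun i j => a i j y).mulVec (fun r => Γ k r j y - Γ' k r j y) = 0 := by
    ext i
    have h₂ := h i k j
    simp only [contravariantSymbols, neg_inj] at h₂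
    simp [Matrix.mulVec, dotProduct, mul_sub, h₂]
  have h₃ := congrArg (fun v => (Matrix.of fun i j => a i j y)⁻¹.mulVec v) h₁
  simp only [Matrix.mulVec_mulVec, Matrix.nonsing_inv_mul _ ha, Matrix.one_mulVec,
    Matrix.mulVec_zero] at h₃
  exact sub_eq_zero.1 (congrFun h₃ i)

theorem PseudoMetric.IsFlatChart.contravariantSymbols_eq_zero {g : PseudoMetric n M}
    (h : g.IsFlatChart φ) (i j k : Fin n) {y : Fin n → ℝ} (hy : y ∈ φ.target) :
    contravariantSymbols (inverseComponents g.form φ) (g.christoffel φ) i j k y = 0 := by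
  simp [contravariantSymbols, PseudoMetric.christoffel, h _ _ _ y hy]

variable [IsManifold 𝓘(ℝ, Fin n → ℝ) ∞ M]

theorem isUnit_det_inverseComponents
    {B : (p : M) → TangentSpace 𝓘(ℝ, Fin n → ℝ) p →L[ℝ] TangentSpace 𝓘(ℝ, Fin n → ℝ) p →L[ℝ] ℝ}
    (hB : ∀ p v, (∀ w, B p v w = 0) → v = 0) (hφ : φ ∈ charts n M) {y : Fin n → ℝ}
    (hy : y ∈ φ.target) : IsUnit (Matrix.of fun i j => inverseComponents B φ i j y).det :=
  (Matrix.isUnit_nonsing_inv_det_iff (A := Matrix.of fun i j => components B φ i j y)).2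
    (isUnit_det_components hB hφ hy)

theorem contDiffOn_inverseComponents
    {B : (p : M) → TangentSpace 𝓘(ℝ, Fin n → ℝ) p →L[ℝ] TangentSpace 𝓘(ℝ, Fin n → ℝ) p →L[ℝ] ℝ}
    (hB : ∀ p v, (∀ w, B p v w = 0) → v = 0) (hφ : φ ∈ charts n M)
    (hs : ∀ i j, ContDiffOn ℝ ∞ (components B φ i j) φ.target) (i j : Fin n) :
    ContDiffOn ℝ ∞ (inverseComponents B φ i j) φ.target :=
  contDiffOn_matrix_inv (A := fun y => Matrix.of fun i j => components B φ i j y) hs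
    (fun _ hy => isUnit_det_components hB hφ hy) i j

theorem sum_inverseComponents_mul_components
    {B : (p : M) → TangentSpace 𝓘(ℝ, Fin n → ℝ) p →L[ℝ] TangentSpace 𝓘(ℝ, Fin n → ℝ) p →L[ℝ] ℝ}
    (hB : ∀ p v, (∀ w, B p v w = 0) → v = 0) (hφ : φ ∈ charts n M) {y : Fin n → ℝ}
    (hy : y ∈ φ.target) (i j : Fin n) :
    ∑ r, inverseComponents B φ i r y * components B φ r j y = if i = j then 1 else 0 := by
  have h := Matrix.nonsing_inv_mul (Matrix.of fun i j => components B φ i j y)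
    (isUnit_det_components hB hφ hy)
  have h₂ := congrFun (congrFun h i) j
  rw [Matrix.mul_apply, Matrix.one_apply] at h₂
  exact h₂

theorem PseudoMetric.contDiffOn_christoffel (g : PseudoMetric n M) (hφ : φ ∈ charts n M)
    (k i j : Fin n) : ContDiffOn ℝ ∞ (g.christoffel φ k i j) φ.target := by
  have hpd : ∀ i j k, ContDiffOn ℝ ∞ (pd k (components g.form φ i j)) φ.target :=
    fun i j k => contDiffOn_pd φ.open_target (g.smooth φ hφ i j) k
  exact contDiffOn_const.mul (ContDiffOn.sum fun r _ =>
    (contDiffOn_inverseComponents g.nondegenerate hφ (g.smooth φ hφ) k r).mul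
      (((hpd r j i).add (hpd r i j)).sub (hpd i j r)))

theorem contDiffOn_quadraticCoefficient {Ω : SymplecticForm n M} {D : Connection n M}
    (hΩ : ∀ i j k, ContDiffOn ℝ ∞ (symplecticSymbols Ω D φ i j k) φ.target)
    (hφ : φ ∈ charts n M) (i j k l : Fin n) :
    ContDiffOn ℝ ∞ (quadraticCoefficient Ω D φ i j k l) φ.target := by
  refine (contDiffOn_const.mul ((contDiffOn_pd φ.open_target (hΩ i j k) l).add
    (contDiffOn_pd φ.open_target (hΩ i j l) k))).sub ?_
  exact ContDiffOn.sum fun p _ => ContDiffOn.sum fun r _ => (Ω.smooth φ hφ p r).mul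
    (contDiffOn_const.mul (((hΩ r i k).mul (hΩ p j l)).add ((hΩ r i l).mul (hΩ p j k))))

/-- Needed for polarisation, since a quadratic form determines only the symmetric part of its
coefficients. -/
theorem quadraticCoefficient_symm (Ω : SymplecticForm n M) (D : Connection n M)
    (i j k l : Fin n) (y : Fin n → ℝ) :
    quadraticCoefficient Ω D φ i j k l y = quadraticCoefficient Ω D φ i j l k y := by
  simp only [quadraticCoefficient, symDeriv]
  congr 1
  · ring
  · refine Finset.sum_congr rfl fun p _ => Finset.sum_congr rfl fun r _ => ?_
    ring

theorem isHamiltonianPencil_of_areCompatible {g : PseudoMetric n M} {Ω : SymplecticForm n M}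
    {D : Connection n M} (hD : IsFlatSymplecticConnection Ω D) (h : AreCompatible g Ω D)
    (hφ : φ ∈ charts n M) : IsHamiltonianPencil φ.target (inverseComponents g.form φ)
      (contravariantSymbols (inverseComponents g.form φ) (g.christoffel φ))
      (inverseComponents Ω.form φ) (quadraticCoefficient Ω D φ) (symplecticSymbols Ω D φ) := by
  have hg := contDiffOn_inverseComponents g.nondegenerate hφ (g.smooth φ hφ)
  have hΩ := contDiffOn_inverseComponents Ω.nondegenerate hφ (Ω.smooth φ hφ)
  have hc := contDiffOn_contravariantSymbols hΩ (hD.smooth φ hφ)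
  refine ⟨φ.open_target, hg, contDiffOn_contravariantSymbols hg (g.contDiffOn_christoffel hφ), hΩ,
    contDiffOn_quadraticCoefficient hc hφ, hc, ?_, ?_, ?_⟩
  · simpa using! h φ hφ 1 0
  · simpa using! h φ hφ 0 1
  · simpa using! h φ hφ 1 1

theorem PseudoMetric.IsFlatChart.fderiv_inverseComponents {g : PseudoMetric n M}
    (h : g.IsFlatChart φ) (hφ : φ ∈ charts n M) (i j : Fin n) {y : Fin n → ℝ}
    (hy : y ∈ φ.target) : fderiv ℝ (inverseComponents g.form φ i j) y = 0 := by
  refine fderiv_matrix_inv_eq_zero φ.open_target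
    (A := fun y => Matrix.of fun i j => components g.form φ i j y) (g.smooth φ hφ)
    (fun _ hz => isUnit_det_components g.nondegenerate hφ hz) hy (fun k l => ?_) i j
  ext v
  change fderiv ℝ (components g.form φ k l) y v = 0
  simp [fderiv_eq_sum_pd, h k l _ y hy]

/-- In a flat chart of the metric the contravariant symbols of a compatible connection are given by
the derivatives of the inverse of the symplectic form. -/
theorem symplecticSymbols_eq {g : PseudoMetric n M} {Ω : SymplecticForm n M} {D : Connection n M}
    (hD : IsFlatSymplecticConnection Ω D) (hc : AreCompatible g Ω D) (hφ : φ ∈ charts n M)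
    (h : g.IsFlatChart φ) {y : Fin n → ℝ} (hy : y ∈ φ.target) (i j k : Fin n) :
    symplecticSymbols Ω D φ i j k y = ∑ s, ∑ r, inverseComponents g.form φ j s y *
      components g.form φ k r y * pd s (inverseComponents Ω.form φ i r) y := by
  have hgs : ∀ k r, components g.form φ k r y = components g.form φ r k y :=
    fun k r => g.symm _ _ _
  have hgs' : ∀ j s, inverseComponents g.form φ j s y = inverseComponents g.form φ s j y := by
    intro j s
    have h₁ : Matrix.transpose (Matrix.of fun i j => components g.form φ i j y) =
        Matrix.of fun i j => components g.form φ i j y := by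
      ext i j
      exact hgs j i
    have h₂ := Matrix.transpose_nonsing_inv (Matrix.of fun i j => components g.form φ i j y)
    rw [h₁] at h₂
    exact congrFun (congrFun h₂ s) j
  have h₁ := fun r => (isHamiltonianPencil_of_areCompatible hD hc hφ).coefficient_eq
    (fun i j y hy => h.fderiv_inverseComponents hφ i j hy)
    (fun i j k y hy => h.contravariantSymbols_eq_zero i j k hy) hy i j r
  simp only [fderiv_eq_sum_pd] at h₁
  -- The relation from the pencil has the lower index of `c` raised by `g`; contracting with
  -- `g_{rk}` lowers it again.
  calc symplecticSymbols Ω D φ i j k y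
      = ∑ m, symplecticSymbols Ω D φ i j m y *
          ∑ r, inverseComponents g.form φ m r y * components g.form φ r k y := by
        simp only [sum_inverseComponents_mul_components g.nondegenerate hφ hy]
        simp
    _ = ∑ r, (∑ m, symplecticSymbols Ω D φ i j m y * inverseComponents g.form φ m r y) *
          components g.form φ r k y := by
        simp only [Finset.mul_sum, Finset.sum_mul]
        rw [Finset.sum_comm]
        simp only [mul_assoc]
    _ = _ := by
        simp only [h₁, Finset.sum_mul]
        rw [Finset.sum_comm]
        refine Finset.sum_congr rfl fun s _ => Finset.sum_congr rfl fun r _ => ?_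
        rw [hgs' j s, hgs k r]
        ring

theorem isDifferentiableAt_coordField (hφ : φ ∈ charts n M) {p : M} (hp : p ∈ φ.source)
    (i : Fin n) : IsDifferentiableAt (coordField φ i) p := by
  have h₁ : ContMDiffAt 𝓘(ℝ, Fin n → ℝ) 𝓘(ℝ, Fin n → ℝ) ∞ φ p :=
    (contMDiffOn_of_mem_maximalAtlas hφ).contMDiffAt (φ.open_source.mem_nhds hp)
  refine MDifferentiableAt.mpullback_vectorField ?_ h₁ ?_ ENat.LEInfty.out
  · exact (contMDiffAt_vectorSpace_iff_contDiffAt.2 contDiffAt_const).mdifferentiableAt one_ne_zero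
  · exact ⟨chartDeriv hφ hp, rfl⟩

/-- A connection is determined by its Christoffel symbols. -/
theorem connection_eq_of_christoffel_eq {D₁ D₂ : Connection n M} (hφ : φ ∈ charts n M) {p : M}
    (hp : p ∈ φ.source)
    (h : ∀ k i j, christoffel D₁ φ k i j (φ p) = christoffel D₂ φ k i j (φ p))
    {X : (p : M) → TangentSpace 𝓘(ℝ, Fin n → ℝ) p} (hX : IsDifferentiableAt X p) :
    D₁ X p = D₂ X p := by
  have hcoord : ∀ i j, D₁ (coordField φ j) p (coordField φ i p) =
      D₂ (coordField φ j) p (coordField φ i p) := by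
    intro i j
    refine (chartDeriv hφ hp).injective (funext fun k => ?_)
    -- The Christoffel symbols are evaluated at `φ.symm (φ p)`, which equals `p` only
    -- propositionally; a free point `q` allows the transport between tangent spaces.
    have h₁ : ∀ q, q = p →
        (mfderiv 𝓘(ℝ, Fin n → ℝ) 𝓘(ℝ, Fin n → ℝ) φ q
          (D₁ (coordField φ j) q (coordField φ i q)) : Fin n → ℝ) k =
        (mfderiv 𝓘(ℝ, Fin n → ℝ) 𝓘(ℝ, Fin n → ℝ) φ q
          (D₂ (coordField φ j) q (coordField φ i q)) : Fin n → ℝ) k →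
        (chartDeriv hφ hp (D₁ (coordField φ j) p (coordField φ i p))) k =
          (chartDeriv hφ hp (D₂ (coordField φ j) p (coordField φ i p))) k := by
      rintro _ rfl h
      exact h
    exact h₁ _ (φ.left_inv hp) (h k i j)
  have hj : ∀ j, D₁ (coordField φ j) p = D₂ (coordField φ j) p := by
    intro j
    ext1 v
    rw [sum_coordField hφ hp v]
    simp only [map_sum, map_smul, hcoord]
  -- The difference of two connections is tensorial, so it is enough that it vanishes on the
  -- coordinate frame at `p`.
  have hd : ∀ j, D₁.difference D₂ p (coordField φ j p) = 0 := fun j => by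
    refine (IsCovariantDerivativeOn.difference_apply _ _ (Set.mem_univ p)
      (isDifferentiableAt_coordField hφ hp j)).trans ?_
    rw [hj, sub_self]
  have hX₂ : D₁.difference D₂ p (X p) = D₁ X p - D₂ X p :=
    IsCovariantDerivativeOn.difference_apply _ _ (Set.mem_univ p) hX
  rw [← sub_eq_zero, ← hX₂, sum_coordField hφ hp (X p)]
  simp [hd]

end TargetGeometry

theorem mainTheorem8 {n : ℕ} {M : Type*} [TopologicalSpace M] [ChartedSpace (Fin n → ℝ) M]
    [IsManifold 𝓘(ℝ, Fin n → ℝ) ∞ M]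
    (g : TargetGeometry.PseudoMetric n M) (hg : g.IsFlat)
    (Ω : TargetGeometry.SymplecticForm n M) :
    -- there is at most one such connection
    (∀ D₁ D₂ : TargetGeometry.Connection n M,
      TargetGeometry.IsFlatSymplecticConnection Ω D₁ →
      TargetGeometry.IsFlatSymplecticConnection Ω D₂ →
      TargetGeometry.AreCompatible g Ω D₁ → TargetGeometry.AreCompatible g Ω D₂ →
      ∀ (X : (p : M) → TangentSpace 𝓘(ℝ, Fin n → ℝ) p) (p : M),
        TargetGeometry.IsDifferentiableAt X p →
        D₁ X p = D₂ X p) ∧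
    -- and it is given, in flat coordinates of the metric, by the explicit formulas
    (∀ D : TargetGeometry.Connection n M,
      TargetGeometry.IsFlatSymplecticConnection Ω D → TargetGeometry.AreCompatible g Ω D →
      ∀ φ ∈ TargetGeometry.charts n M, g.IsFlatChart φ → ∀ y ∈ φ.target,
        (∀ i j k, TargetGeometry.symplecticSymbols Ω D φ i j k y =
          ∑ s, ∑ r, TargetGeometry.inverseComponents g.form φ j s y *
            TargetGeometry.components g.form φ k r y *
            TargetGeometry.pd s (TargetGeometry.inverseComponents Ω.form φ i r) y) ∧
        (∀ i j k l, TargetGeometry.quadraticCoefficient Ω D φ i j k l y =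
          TargetGeometry.symDeriv (TargetGeometry.symplecticSymbols Ω D φ) i j k l y)) := by
  open TargetGeometry in
  refine ⟨fun D₁ D₂ h₁ h₂ hc₁ hc₂ X p hX => ?_, fun D hD hc φ hφ hflat y hy =>
    ⟨symplecticSymbols_eq hD hc hφ hflat hy, fun i j k l => ?_⟩⟩
  · have hφ : chartAt (Fin n → ℝ) p ∈ charts n M := IsManifold.chart_mem_maximalAtlas p
    have hp := mem_chart_source (Fin n → ℝ) p
    have hy := (chartAt (Fin n → ℝ) p).map_source hp
    refine connection_eq_of_christoffel_eq hφ hp (fun k i j => ?_) hX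
    exact eq_of_contravariantSymbols_eq (isUnit_det_inverseComponents Ω.nondegenerate hφ hy)
      (fun i j k => (isHamiltonianPencil_of_areCompatible h₁ hc₁ hφ).coefficient_unique
        (isHamiltonianPencil_of_areCompatible h₂ hc₂ hφ) hy
        (isUnit_det_inverseComponents g.nondegenerate hφ hy) i j k) k i j
  · exact (isHamiltonianPencil_of_areCompatible hD hc hφ).quadratic_coefficient_eq
      (fun i j y hy => hflat.fderiv_inverseComponents hφ i j hy)
      (fun i j k y hy => hflat.contravariantSymbols_eq_zero i j k hy) hy
      (isUnit_det_inverseComponents g.nondegenerate hφ hy)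
      (fun i j k l => quadraticCoefficient_symm Ω D i j k l y) i j k l
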